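/- Let $E$ be an elliptic curve and $n\ge 1$. Let $M(A_{n-1})\subset E^n$ be the complement of the divisors $D_{ij}=\{P_i=P_j\}$, $1\le i<j\le n$ (the configuration space of $n$ ordered points of $E$), and let $M(A_{n-1})/E\subset E^n/E\cong E^{n-1}$ be its quotient by simultaneous translations. The second page $E_2^{\bullet,\bullet}(M(A_{n-1})/E)$ of the Leray spectral sequence (with rational coefficients) of the inclusion $M(A_{n-1})/E\hookrightarrow E^n/E$ is the bigraded differential algebra given by the following combinatorial (Kriz) model: it is the graded-commutative $\mathbb{Q}$-algebra generated by $x_{ij},y_{ij}$ of bidegree $(1,0)$ and $\omega_{ij}$ of bidegree $(0,1)$, $1\le i<j\le n$, with relations - $x_{ij}\omega_{ij}=0$ and $y_{ij}\omega_{ij}=0$; - $\omega_{il}\omega_{jl}-\omega_{ij}\omega_{jl}+\omega_{ij}\omega_{il}=0$ for $i<j<l$; - $\sum k_{ij}x_{ij}=0$ and $\sum k_{ij}y_{ij}=0$ for every rational vector $k$ in the kernel of the matrix whose columns are the coefficients of the equations of the divisors $D_{ij}/E$ (so that $x_{ij}+x_{jl}=x_{il}$ and $y_{ij}+y_{jl}=y_{il}$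 for $i<j<l$), with the differential $\mathrm{d}$ of bidegree $(2,-1)$ determined by $\mathrm{d}x_{ij}=\mathrm{d}y_{ij}=0$, $\mathrm{d}\omega_{ij}=x_{ij}y_{ij}$ and the graded Leibniz rule. The third page $E_3^{\bullet,\bullet}(M(A_{n-1})/E)$ is its cohomology. The group $\operatorname{SL}_2(\mathbb{Q})$ acts on both pages: it acts on each plane $\langle x_{ij},y_{ij}\rangle$ by the standard representation with basis $x_{ij},y_{ij}$, and it fixes the $\omega_{ij}$. Let $\mathbb{V}_k$ be the irreducible representation of $\operatorname{SL}_2(\mathbb{Q})$ of dimension $k+1$ (homogeneous polynomials of degree $k$ in two variables), and let $e_i^{p,q}(n,E)_k$ be the multiplicity of $\mathbb{V}_k$ in $E_i^{p,q}(M(A_{n-1})/E)$, $i=2,3$. **Proposition.** For all $n\ge 1$ and $p\ge 0$, \[ e_3^{p,1}(n,E)_p=\binom{n}{p+2}\binom{p+1}{2}, \] and moreover \[ e_3^{p,1}(n,E)_p=e_2^{p,1}(n,E)_p-e_2^{p+2,0}(n,E)_p . \] -/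

import Mathlib

noncomputable section

namespace BraidElliptic

open Matrix

/-! ### The arrangement

The quotient by the diagonal `E` of the braid arrangement `D i j = {P i = P j}` of `E ^ n`, in the
coordinates `t r = P r - P (r + 1)` on `E ^ n / E = E ^ (n - 1)`, is the unimodular essential
arrangement of the divisors `t i + t (i + 1) + ... + t (j - 1) = 0` for `i < j`. -/

/-- The index set of the divisors `D i j`, `i < j`. -/
abbrev Edge (n : ℕ) := {e : Fin n × Fin n // e.1 < e.2}

/-- The divisor `D i j`. -/
def edge {n : ℕ} (i j : Fin n) (h : i < j) : Edge n := ⟨(i, j), h⟩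

/-- The defining matrix of the arrangement: the column `(i, j)` is the equation
`t i + ... + t (j - 1) = 0`. -/
def definingMatrix (n : ℕ) : Matrix (Fin (n - 1)) (Edge n) ℤ :=
  fun r e => if e.1.1.val ≤ r.val ∧ r.val < e.1.2.val then 1 else 0

/-- `k` is a rational vector in the kernel of the defining matrix. -/
def IsRelation {n : ℕ} (k : Edge n → ℚ) : Prop :=
  (definingMatrix n).map (Int.cast : ℤ → ℚ) *ᵥ k = 0

lemma isRelation_triangle {n : ℕ} {i j l : Fin n} (hij : i < j) (hjl : j < l) :
    IsRelation (Pi.single (edge i j hij) (1 : ℚ) + Pi.single (edge j l hjl) 1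
      - Pi.single (edge i l (hij.trans hjl)) 1) := by
  have h1 := Fin.lt_def.1 hij
  have h2 := Fin.lt_def.1 hjl
  funext r
  simp only [Matrix.mulVec_sub, Matrix.mulVec_add, Matrix.mulVec_single_one, Pi.add_apply,
    Pi.sub_apply, Matrix.col_apply, Matrix.map_apply, definingMatrix, edge, Pi.zero_apply]
  by_cases a : i.val ≤ r.val <;> by_cases b : r.val < j.val <;> by_cases c : r.val < l.val <;>
    by_cases d : j.val ≤ r.val <;> simp [a, b, c, d] <;> omega

/-! ### The second page as a differential graded algebra -/

/-- Generators: `x`, `y` are the pullbacks along `D i j`'s equation of a basis of `H ^ 1 (E; ℚ)`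
(bidegree `(1, 0)`), and `w` is the generator attached to the divisor (bidegree `(0, 1)`). -/
inductive Gen (n : ℕ) : Type
  | x (e : Edge n) : Gen n
  | y (e : Edge n) : Gen n
  | w (e : Edge n) : Gen n

/-- The free graded commutative algebra on the generators; as they all have odd total degree, it
is an exterior algebra. -/
abbrev Free (n : ℕ) := ExteriorAlgebra ℚ (Gen n →₀ ℚ)

/-- A generator, as an element of the free graded commutative algebra. -/
def Free.gen {n : ℕ} (g : Gen n) : Free n := ExteriorAlgebra.ι ℚ (Finsupp.single g 1)

open Gen Free in
/-- The relations. The generators `x`, `y` of a divisor vanish on the divisor; the generators `w`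
satisfy the Orlik-Solomon (Arnold) relations of the braid arrangement; the classes `x`, `y` satisfy
the linear relations given by the kernel of the defining matrix. -/
inductive Rel (n : ℕ) : Free n → Free n → Prop
  | x_mul_w (e : Edge n) : Rel n (gen (x e) * gen (w e)) 0
  | y_mul_w (e : Edge n) : Rel n (gen (y e) * gen (w e)) 0
  | arnold (i j l : Fin n) (hij : i < j) (hjl : j < l) :
      Rel n (gen (w (edge i l (hij.trans hjl))) * gen (w (edge j l hjl))
        - gen (w (edge i j hij)) * gen (w (edge j l hjl))
        + gen (w (edge i j hij)) * gen (w (edge i l (hij.trans hjl)))) 0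
  | lin_x (k : Edge n → ℚ) (hk : IsRelation k) : Rel n (∑ e, k e • gen (x e)) 0
  | lin_y (k : Edge n → ℚ) (hk : IsRelation k) : Rel n (∑ e, k e • gen (y e)) 0

/-- The bigraded algebra `E₂(M(A_{n-1})/E)`: the model of the complement of the arrangement above
by generators and relations (the Kriz model of the configuration space of `n` points of an
elliptic curve, modulo translations). -/
abbrev E2Alg (n : ℕ) := RingQuot (Rel n)

section Generators

variable {n : ℕ}

/-- The class of a linear combination of generators. -/
def cls : (Gen n →₀ ℚ) →ₗ[ℚ] E2Alg n :=
  (RingQuot.mkAlgHom ℚ (Rel n)).toLinearMap ∘ₗ ExteriorAlgebra.ι ℚ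

/-- The class of a generator. -/
def gen (g : Gen n) : E2Alg n := RingQuot.mkAlgHom ℚ (Rel n) (Free.gen g)

lemma cls_single (g : Gen n) (c : ℚ) : cls (Finsupp.single g c) = c • gen g := by
  have : Finsupp.single g c = c • Finsupp.single g (1 : ℚ) := by simp
  rw [this, map_smul]
  rfl

/-- `x i j`. -/
def X (e : Edge n) : E2Alg n := gen (Gen.x e)

/-- `y i j`. -/
def Y (e : Edge n) : E2Alg n := gen (Gen.y e)

/-- `ω i j`. -/
def W (e : Edge n) : E2Alg n := gen (Gen.w e)

lemma cls_sq (m : Gen n →₀ ℚ) : cls m * cls m = 0 := by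
  simp only [cls, LinearMap.comp_apply, AlgHom.toLinearMap_apply]
  rw [← map_mul, ExteriorAlgebra.ι_sq_zero, map_zero]

lemma cls_anticomm (m m' : Gen n →₀ ℚ) : cls m * cls m' = -(cls m' * cls m) := by
  have h := cls_sq (m + m')
  rw [map_add, mul_add, add_mul, add_mul, cls_sq, cls_sq, zero_add, add_zero] at h
  exact eq_neg_of_add_eq_zero_right h

lemma gen_eq (g : Gen n) : gen g = cls (Finsupp.single g 1) := rfl

lemma gen_sq (g : Gen n) : gen g * gen g = 0 := cls_sq _

lemma gen_anticomm (g h : Gen n) : gen g * gen h = -(gen h * gen g) := cls_anticomm _ _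

lemma X_mul_W (e : Edge n) : X e * W e = 0 := by
  simpa [X, Y, W, gen] using RingQuot.mkAlgHom_rel ℚ (Rel.x_mul_w e)

lemma Y_mul_W (e : Edge n) : Y e * W e = 0 := by
  simpa [X, Y, W, gen] using RingQuot.mkAlgHom_rel ℚ (Rel.y_mul_w e)

lemma arnold {i j l : Fin n} (hij : i < j) (hjl : j < l) :
    W (edge i l (hij.trans hjl)) * W (edge j l hjl) - W (edge i j hij) * W (edge j l hjl)
      + W (edge i j hij) * W (edge i l (hij.trans hjl)) = 0 := by
  simpa [X, Y, W, gen] using RingQuot.mkAlgHom_rel ℚ (Rel.arnold i j l hij hjl)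

lemma lin_X {k : Edge n → ℚ} (hk : IsRelation k) : ∑ e, k e • X e = 0 := by
  simpa [X, Y, W, gen] using RingQuot.mkAlgHom_rel ℚ (Rel.lin_x k hk)

lemma lin_Y {k : Edge n → ℚ} (hk : IsRelation k) : ∑ e, k e • Y e = 0 := by
  simpa [X, Y, W, gen] using RingQuot.mkAlgHom_rel ℚ (Rel.lin_y k hk)

lemma sum_triangle {B : Type*} [AddCommGroup B] [Module ℚ B] (f : Edge n → B) {i j l : Fin n}
    (hij : i < j) (hjl : j < l) :
    ∑ e, (Pi.single (edge i j hij) (1 : ℚ) + Pi.single (edge j l hjl) 1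
      - Pi.single (edge i l (hij.trans hjl)) 1 : Edge n → ℚ) e • f e
      = f (edge i j hij) + f (edge j l hjl) - f (edge i l (hij.trans hjl)) := by
  simp [sub_smul, add_smul, Finset.sum_add_distrib, Finset.sum_sub_distrib, Pi.single_apply,
    ite_smul]

lemma X_triangle {i j l : Fin n} (hij : i < j) (hjl : j < l) :
    X (edge i l (hij.trans hjl)) = X (edge i j hij) + X (edge j l hjl) := by
  have h := lin_X (isRelation_triangle hij hjl)
  rw [sum_triangle] at h
  exact (sub_eq_zero.1 h).symm

lemma Y_triangle {i j l : Fin n} (hij : i < j) (hjl : j < l) :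
    Y (edge i l (hij.trans hjl)) = Y (edge i j hij) + Y (edge j l hjl) := by
  have h := lin_Y (isRelation_triangle hij hjl)
  rw [sum_triangle] at h
  exact (sub_eq_zero.1 h).symm

lemma algHom_ext {B : Type*} [Ring B] [Algebra ℚ B] {f g : E2Alg n →ₐ[ℚ] B}
    (h : ∀ a, f (gen a) = g (gen a)) : f = g := by
  apply RingQuot.ringQuot_ext'
  apply ExteriorAlgebra.hom_ext
  apply Finsupp.lhom_ext'
  intro a
  apply LinearMap.ext_ring
  exact h a

end Generators

/-! ### The differential -/

section Differential

variable {n : ℕ}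

/-- The differential on generators: `x, y ↦ 0` and `ω ↦ x y`. -/
def dGen : Gen n → E2Alg n
  | Gen.x _ => 0
  | Gen.y _ => 0
  | Gen.w e => X e * Y e

/-- The linear extension of `dGen`. -/
def dLin : (Gen n →₀ ℚ) →ₗ[ℚ] E2Alg n := Finsupp.linearCombination ℚ dGen

lemma dGen_comm (g h : Gen n) : dGen g * gen h = gen h * dGen g := by
  cases g with
  | x e => simp [dGen]
  | y e => simp [dGen]
  | w e =>
    simp only [dGen, X, Y]
    rw [mul_assoc, gen_anticomm (Gen.y e) h, mul_neg, ← mul_assoc, gen_anticomm (Gen.x e) h,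
      neg_mul, neg_neg, mul_assoc]

lemma dLin_comm (m m' : Gen n →₀ ℚ) : dLin m * cls m' = cls m' * dLin m := by
  induction m using Finsupp.induction_linear with
  | zero => simp
  | add a b ha hb => rw [map_add, add_mul, mul_add, ha, hb]
  | single g c =>
    induction m' using Finsupp.induction_linear with
    | zero => simp
    | add a b ha hb => rw [map_add, add_mul, mul_add, ha, hb]
    | single h c' =>
      simp only [dLin, Finsupp.linearCombination_single, cls_single, smul_mul_assoc,
        mul_smul_comm, dGen_comm, smul_comm c c']

/-- The linear map `m ↦ (-m, d m; 0, m)` to upper triangular matrices. -/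
def triLin : (Gen n →₀ ℚ) →ₗ[ℚ] Matrix (Fin 2) (Fin 2) (E2Alg n) where
  toFun m := !![-cls m, dLin m; 0, cls m]
  map_add' a b := by
    ext i j; fin_cases i <;> fin_cases j <;> simp [add_comm]
  map_smul' c a := by
    ext i j; fin_cases i <;> fin_cases j <;> simp

lemma triLin_sq (m : Gen n →₀ ℚ) : triLin m * triLin m = 0 := by
  ext i j
  fin_cases i <;> fin_cases j <;> simp [triLin, Matrix.mul_apply, cls_sq, dLin_comm]

/-- `triLin` as a homomorphism on the free graded commutative algebra. -/
def triFree : Free n →ₐ[ℚ] Matrix (Fin 2) (Fin 2) (E2Alg n) :=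
  ExteriorAlgebra.lift ℚ ⟨triLin, triLin_sq⟩

lemma triFree_gen (g : Gen n) : triFree (Free.gen g) = !![-gen g, dGen g; 0, gen g] := by
  simp only [triFree, Free.gen, ExteriorAlgebra.lift_ι_apply]
  simp [triLin, dLin, gen_eq]

lemma XY_mul_W_eq {e f h : Edge n} (s : ℚ) (hs : s * s = 1) (hX : X e * W h = s • (X f * W h))
    (hY : Y e * W h = s • (Y f * W h)) : X e * Y e * W h = X f * Y f * W h := by
  have h1 : X e * Y f = -(Y f * X e) := gen_anticomm _ _
  have h2 : X f * Y f = -(Y f * X f) := gen_anticomm _ _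
  rw [mul_assoc, hY, mul_smul_comm, ← mul_assoc, h1, neg_mul, mul_assoc, hX, mul_smul_comm, h2,
    neg_mul, mul_assoc, smul_neg, smul_smul, hs, one_smul]

lemma W_mul_XY (e f : Edge n) : W e * (X f * Y f) = X f * Y f * W e :=
  (dGen_comm (Gen.w f) (Gen.w e)).symm

lemma arnold_d {i j l : Fin n} (hij : i < j) (hjl : j < l) :
    (-(W (edge i l (hij.trans hjl)) * (X (edge j l hjl) * Y (edge j l hjl)))
      + X (edge i l (hij.trans hjl)) * Y (edge i l (hij.trans hjl)) * W (edge j l hjl))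
    - (-(W (edge i j hij) * (X (edge j l hjl) * Y (edge j l hjl)))
      + X (edge i j hij) * Y (edge i j hij) * W (edge j l hjl))
    + (-(W (edge i j hij) * (X (edge i l (hij.trans hjl)) * Y (edge i l (hij.trans hjl))))
      + X (edge i j hij) * Y (edge i j hij) * W (edge i l (hij.trans hjl))) = 0 := by
  have hX := X_triangle hij hjl
  have hY := Y_triangle hij hjl
  set a := edge i j hij
  set b := edge j l hjl
  set c := edge i l (hij.trans hjl)
  have h1 : X c * Y c * W b = X a * Y a * W b :=
    XY_mul_W_eq 1 (by norm_num) (by rw [hX, add_mul, X_mul_W, add_zero, one_smul])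
      (by rw [hY, add_mul, Y_mul_W, add_zero, one_smul])
  have h2 : X c * Y c * W a = X b * Y b * W a :=
    XY_mul_W_eq 1 (by norm_num) (by rw [hX, add_mul, X_mul_W, zero_add, one_smul])
      (by rw [hY, add_mul, Y_mul_W, zero_add, one_smul])
  have h3 : X a * Y a * W c = X b * Y b * W c := by
    apply XY_mul_W_eq (-1) (by norm_num)
    · rw [eq_sub_of_add_eq hX.symm, sub_mul, X_mul_W, zero_sub, neg_one_smul]
    · rw [eq_sub_of_add_eq hY.symm, sub_mul, Y_mul_W, zero_sub, neg_one_smul]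
  simp only [W_mul_XY, h1, h2, h3]
  abel

lemma triFree_rel ⦃a b : Free n⦄ (h : Rel n a b) : triFree a = triFree b := by
  induction h with
  | x_mul_w e =>
    have h1 : gen (Gen.x e) * gen (Gen.w e) = 0 := X_mul_W e
    have h2 : gen (Gen.x e) * (X e * Y e) = 0 := by
      rw [← mul_assoc, X, gen_sq, zero_mul]
    rw [map_mul, triFree_gen, triFree_gen, map_zero]
    ext i j
    fin_cases i <;> fin_cases j <;> simp [Matrix.mul_apply, dGen, h1, h2]
  | y_mul_w e =>
    have h1 : gen (Gen.y e) * gen (Gen.w e) = 0 := Y_mul_W e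
    have h2 : gen (Gen.y e) * (X e * Y e) = 0 := by
      have h3 := dGen_comm (Gen.w e) (Gen.y e)
      simp only [dGen] at h3
      rw [← h3, mul_assoc, Y, gen_sq, mul_zero]
    rw [map_mul, triFree_gen, triFree_gen, map_zero]
    ext i j
    fin_cases i <;> fin_cases j <;> simp [Matrix.mul_apply, dGen, h1, h2]
  | arnold i j l hij hjl =>
    have h1 := arnold hij hjl
    have h2 := arnold_d hij hjl
    simp only [map_add, map_sub, map_mul, triFree_gen, map_zero]
    ext r s
    fin_cases r <;> fin_cases s <;>
      simp [dGen, ← W.eq_1, h1, h2]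
  | lin_x k hk =>
    have h1 : ∑ e, k e • gen (Gen.x e) = 0 := lin_X hk
    simp only [map_sum, map_smul, triFree_gen, map_zero]
    ext r s
    fin_cases r <;> fin_cases s <;> simp [Matrix.sum_apply, dGen, h1]
  | lin_y k hk =>
    have h1 : ∑ e, k e • gen (Gen.y e) = 0 := lin_Y hk
    simp only [map_sum, map_smul, triFree_gen, map_zero]
    ext r s
    fin_cases r <;> fin_cases s <;> simp [Matrix.sum_apply, dGen, h1]

/-- The algebra homomorphism `a ↦ (ε a, d a; 0, a)`, where `ε` is the sign `(-1) ^ (p + q)` on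
bidegree `(p, q)`; its multiplicativity is the graded Leibniz rule for `d`. -/
def tri : E2Alg n →ₐ[ℚ] Matrix (Fin 2) (Fin 2) (E2Alg n) :=
  RingQuot.liftAlgHom ℚ ⟨triFree, triFree_rel⟩

lemma tri_gen (g : Gen n) : tri (gen g) = !![-gen g, dGen g; 0, gen g] := by
  rw [tri, gen, RingQuot.liftAlgHom_mkAlgHom_apply, triFree_gen]; rfl

/-- The differential of the second page: the derivation, in the graded sense, with `d x = d y = 0`
and `d ω = x y`. -/
def d : E2Alg n →ₗ[ℚ] E2Alg n where
  toFun a := tri a 0 1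
  map_add' a b := by simp
  map_smul' c a := by simp

lemma tri_cls (m : Gen n →₀ ℚ) : tri (cls m) = !![-cls m, dLin m; 0, cls m] := by
  simp only [cls, LinearMap.comp_apply, AlgHom.toLinearMap_apply, tri,
    RingQuot.liftAlgHom_mkAlgHom_apply, triFree, ExteriorAlgebra.lift_ι_apply]
  rfl

/-- A subspace containing `1` and stable by left multiplication by generators is everything. -/
lemma eq_top_of_gen_mul (S : Submodule ℚ (E2Alg n)) (h1 : (1 : E2Alg n) ∈ S)
    (hS : ∀ m, ∀ a ∈ S, cls m * a ∈ S) (a : E2Alg n) : a ∈ S := by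
  have key : ∀ b : Free n, ∀ a ∈ S, RingQuot.mkAlgHom ℚ (Rel n) b * a ∈ S := by
    intro b
    induction b using ExteriorAlgebra.induction with
    | algebraMap r =>
      intro a ha
      rw [AlgHom.commutes, ← Algebra.smul_def]
      exact S.smul_mem r ha
    | ι m => exact fun a ha => hS m a ha
    | mul b c hb hc =>
      intro a ha
      rw [map_mul, mul_assoc]
      exact hb _ (hc _ ha)
    | add b c hb hc =>
      intro a ha
      rw [map_add, add_mul]
      exact S.add_mem (hb _ ha) (hc _ ha)
  obtain ⟨b, rfl⟩ := RingQuot.mkAlgHom_surjective ℚ (Rel n) a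
  simpa using key b 1 h1

lemma tri_lower (a : E2Alg n) : tri a 1 1 = a ∧ tri a 1 0 = 0 := by
  let S : Submodule ℚ (E2Alg n) :=
    { carrier := {a | tri a 1 1 = a ∧ tri a 1 0 = 0}
      zero_mem' := by simp
      add_mem' := by
        rintro a b ⟨h1, h2⟩ ⟨h3, h4⟩
        simp [h1, h2, h3, h4]
      smul_mem' := by
        rintro c a ⟨h1, h2⟩
        simp [h1, h2] }
  refine eq_top_of_gen_mul S ⟨by simp, by simp⟩ ?_ a
  rintro m a ⟨h1, h2⟩
  constructor <;> simp [tri_cls, Matrix.mul_apply, h1, h2]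

lemma d_one : d (1 : E2Alg n) = 0 := by
  simp [d]

lemma d_cls (m : Gen n →₀ ℚ) : d (cls m) = dLin m := by
  simp [d, tri_cls]

/-- The graded Leibniz rule for a product with an element of total degree one. -/
lemma d_cls_mul (m : Gen n →₀ ℚ) (a : E2Alg n) :
    d (cls m * a) = d (cls m) * a - cls m * d a := by
  rw [d_cls]
  simp [d, tri_cls, Matrix.mul_apply, (tri_lower a).1]
  abel

lemma d_X (e : Edge n) : d (X e) = 0 := by
  simp [d, X, tri_gen, dGen]

lemma d_Y (e : Edge n) : d (Y e) = 0 := by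
  simp [d, Y, tri_gen, dGen]

lemma d_W (e : Edge n) : d (W e) = X e * Y e := by
  simp [d, W, tri_gen, dGen]

lemma d_dLin_mul (m : Gen n →₀ ℚ) (a : E2Alg n) : d (dLin m * a) = dLin m * d a := by
  induction m using Finsupp.induction_linear with
  | zero => simp
  | add b c hb hc => rw [map_add, add_mul, map_add, hb, hc, add_mul]
  | single g c =>
    rw [dLin, Finsupp.linearCombination_single, smul_mul_assoc, map_smul, smul_mul_assoc]
    congr 1
    cases g with
    | x e => simp [dGen]
    | y e => simp [dGen]
    | w e =>
      have hx (b : E2Alg n) : d (X e * b) = -(X e * d b) := by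
        have := d_cls_mul (Finsupp.single (Gen.x e) 1) b
        rw [← gen_eq] at this
        rw [X, this, ← X, d_X]; simp
      have hy (b : E2Alg n) : d (Y e * b) = -(Y e * d b) := by
        have := d_cls_mul (Finsupp.single (Gen.y e) 1) b
        rw [← gen_eq] at this
        rw [Y, this, ← Y, d_Y]; simp
      simp only [dGen]
      rw [mul_assoc, hx, hy]
      simp [mul_assoc]

lemma d_d (a : E2Alg n) : d (d a) = 0 := by
  refine eq_top_of_gen_mul (LinearMap.ker (d ∘ₗ d)) (by simp [d_one]) ?_ a
  intro m a ha
  simp only [LinearMap.mem_ker, LinearMap.comp_apply] at ha ⊢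
  rw [d_cls_mul, map_sub, d_cls_mul, d_cls, d_dLin_mul, ha]
  simp

end Differential

/-! ### The bigrading and the third page -/

section Pages

/-- The bidegree `(1, 0)` part: the span of the `x` and `y`. -/
def V10 (n : ℕ) : Submodule ℚ (E2Alg n) := Submodule.span ℚ (Set.range X ∪ Set.range Y)

/-- The bidegree `(0, 1)` part: the span of the `ω`. -/
def V01 (n : ℕ) : Submodule ℚ (E2Alg n) := Submodule.span ℚ (Set.range W)

/-- `E₂^{p,q}(M(A_{n-1})/E)`: the span of the products of `p` elements of bidegree `(1, 0)` and `q`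
elements of bidegree `(0, 1)`. -/
def E2 (n p q : ℕ) : Submodule ℚ (E2Alg n) := V10 n ^ p * V01 n ^ q

/-- The kernel of `d` on `E₂^{p,q}`. -/
def cycles (n p q : ℕ) : Submodule ℚ (E2Alg n) := E2 n p q ⊓ LinearMap.ker d

/-- The image of `d : E₂^{p-2,q+1} → E₂^{p,q}`, where `E₂^{p-2,q+1} = 0` for `p < 2`. -/
def boundaries (n : ℕ) : ℕ → ℕ → Submodule ℚ (E2Alg n)
  | 0, _ => ⊥
  | 1, _ => ⊥
  | p + 2, q => (E2 n p (q + 1)).map d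

/-- `E₃^{p,q}(M(A_{n-1})/E)`, the cohomology of the second page at bidegree `(p, q)`. -/
abbrev E3 (n p q : ℕ) : Type := cycles n p q ⧸ (boundaries n p q).submoduleOf (cycles n p q)

variable {n : ℕ}

lemma d_V10_mul {v : E2Alg n} (hv : v ∈ V10 n) (a : E2Alg n) : d (v * a) = -(v * d a) := by
  induction hv using Submodule.span_induction with
  | mem v hv =>
    rcases hv with ⟨e, rfl⟩ | ⟨e, rfl⟩
    · have := d_cls_mul (Finsupp.single (Gen.x e) 1) a
      rw [← gen_eq] at this
      rw [X, this, ← X, d_X]; simp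
    · have := d_cls_mul (Finsupp.single (Gen.y e) 1) a
      rw [← gen_eq] at this
      rw [Y, this, ← Y, d_Y]; simp
  | zero => simp
  | add v w _ _ hv hw => rw [add_mul, map_add, hv, hw, add_mul]; abel
  | smul c v _ hv => rw [smul_mul_assoc, map_smul, hv]; simp

lemma V01_mul_V10 : V01 n * (V10 n ^ 2) ≤ V10 n ^ 2 * V01 n := by
  have h1 : V01 n * V10 n ≤ V10 n * V01 n := by
    rw [V01, V10, Submodule.span_mul_span, Submodule.span_le]
    rintro _ ⟨_, ⟨e, rfl⟩, v, hv, rfl⟩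
    have : W e * v = -(v * W e) := by
      rcases hv with ⟨f, rfl⟩ | ⟨f, rfl⟩ <;> exact gen_anticomm _ _
    simp only [this]
    exact Submodule.neg_mem _ (Submodule.mul_mem_mul (Submodule.subset_span hv)
      (Submodule.subset_span ⟨e, rfl⟩))
  calc V01 n * V10 n ^ 2 = V01 n * V10 n * V10 n := by rw [pow_two, mul_assoc]
    _ ≤ V10 n * V01 n * V10 n := mul_le_mul_left h1 _
    _ = V10 n * (V01 n * V10 n) := by rw [mul_assoc]
    _ ≤ V10 n * (V10 n * V01 n) := mul_le_mul_right h1 _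
    _ = V10 n ^ 2 * V01 n := by rw [pow_two, mul_assoc]

lemma d_V01_pow (q : ℕ) : (V01 n ^ (q + 1)).map d ≤ V10 n ^ 2 * V01 n ^ q := by
  have hXY (e : Edge n) : X e * Y e ∈ V10 n ^ 2 := by
    rw [pow_two]
    exact Submodule.mul_mem_mul (Submodule.subset_span (Or.inl ⟨e, rfl⟩))
      (Submodule.subset_span (Or.inr ⟨e, rfl⟩))
  have hd (e : Edge n) (b : E2Alg n) : d (W e * b) = X e * Y e * b - W e * d b := by
    have := d_cls_mul (Finsupp.single (Gen.w e) 1) b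
    rw [← gen_eq] at this
    rw [W, this, ← W, d_W]
  have key (q : ℕ) (T : Submodule ℚ (E2Alg n))
      (h : ∀ e, ∀ b ∈ V01 n ^ q, d (W e * b) ∈ T) : (V01 n ^ (q + 1)).map d ≤ T := by
    rw [Submodule.map_le_iff_le_comap, pow_succ', Submodule.mul_le]
    intro w hw b hb
    induction hw using Submodule.span_induction with
    | mem w hw => obtain ⟨e, rfl⟩ := hw; exact h e b hb
    | zero => simp
    | add v w _ _ hv hw => rw [add_mul]; exact Submodule.add_mem _ hv hw
    | smul c v _ hv => rw [smul_mul_assoc]; exact Submodule.smul_mem _ c hv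
  induction q with
  | zero =>
    refine key 0 _ fun e b hb => ?_
    rw [pow_zero, Submodule.mem_one] at hb
    obtain ⟨c, rfl⟩ := hb
    have : d (algebraMap ℚ (E2Alg n) c) = 0 := by
      rw [Algebra.algebraMap_eq_smul_one, map_smul, d_one, smul_zero]
    rw [hd, this, mul_zero, sub_zero, pow_zero]
    exact Submodule.mul_mem_mul (hXY e) (Submodule.algebraMap_mem c)
  | succ q ih =>
    refine key (q + 1) _ fun e b hb => ?_
    rw [hd]
    refine Submodule.sub_mem _ (Submodule.mul_mem_mul (hXY e) hb) ?_
    have h1 : W e * d b ∈ V01 n * (V10 n ^ 2 * V01 n ^ q) :=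
      Submodule.mul_mem_mul (Submodule.subset_span ⟨e, rfl⟩) (ih ⟨b, hb, rfl⟩)
    have h2 : V01 n * (V10 n ^ 2 * V01 n ^ q) ≤ V10 n ^ 2 * V01 n ^ (q + 1) := by
      calc V01 n * (V10 n ^ 2 * V01 n ^ q) = V01 n * V10 n ^ 2 * V01 n ^ q :=
            (mul_assoc (V01 n) (V10 n ^ 2) (V01 n ^ q)).symm
        _ ≤ V10 n ^ 2 * V01 n * V01 n ^ q := mul_le_mul' V01_mul_V10 le_rfl
        _ = V10 n ^ 2 * (V01 n * V01 n ^ q) := mul_assoc (V10 n ^ 2) (V01 n) (V01 n ^ q)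
        _ = V10 n ^ 2 * V01 n ^ (q + 1) := by rw [pow_succ' (V01 n) q]
    exact h2 h1

/-- The differential has bidegree `(2, -1)`. -/
lemma d_E2 (p q : ℕ) : (E2 n p (q + 1)).map d ≤ E2 n (p + 2) q := by
  induction p with
  | zero => simpa [E2] using d_V01_pow q
  | succ p ih =>
    rw [Submodule.map_le_iff_le_comap, E2, pow_succ', mul_assoc, Submodule.mul_le]
    intro v hv a ha
    rw [Submodule.mem_comap, d_V10_mul hv]
    refine Submodule.neg_mem _ ?_
    have : E2 n (p + 1 + 2) q = V10 n * E2 n (p + 2) q := by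
      rw [E2, E2, ← mul_assoc, ← pow_succ']
    rw [this]
    exact Submodule.mul_mem_mul hv (ih ⟨a, ha, rfl⟩)

lemma boundaries_le_cycles (p q : ℕ) : boundaries n p q ≤ cycles n p q := by
  match p with
  | 0 => exact bot_le
  | 1 => exact bot_le
  | p + 2 =>
    refine le_inf (d_E2 p q) ?_
    rintro _ ⟨a, _, rfl⟩
    exact d_d a

end Pages

/-! ### The action of `SL₂(ℚ)` -/

section Action

/-- The group `SL₂(ℚ)`. -/
abbrev SL2 := Matrix.SpecialLinearGroup (Fin 2) ℚ

variable {n : ℕ}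

/-- The action on the linear span of the generators: the standard representation on the plane with
basis `x, y`, and the trivial one on `ω`. -/
def actGen (g : SL2) : Gen n → (Gen n →₀ ℚ)
  | Gen.x e => Finsupp.single (Gen.x e) (g 0 0) + Finsupp.single (Gen.y e) (g 1 0)
  | Gen.y e => Finsupp.single (Gen.x e) (g 0 1) + Finsupp.single (Gen.y e) (g 1 1)
  | Gen.w e => Finsupp.single (Gen.w e) 1

/-- The action on the free graded commutative algebra, followed by the quotient map. -/
def actFree (g : SL2) : Free n →ₐ[ℚ] E2Alg n :=
  ExteriorAlgebra.lift ℚ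
    ⟨cls ∘ₗ Finsupp.linearCombination ℚ (actGen g), fun _ => cls_sq _⟩

lemma actFree_gen (g : SL2) (a : Gen n) : actFree g (Free.gen a) = cls (actGen g a) := by
  simp [actFree, Free.gen]

lemma actFree_x (g : SL2) (e : Edge n) :
    actFree g (Free.gen (Gen.x e)) = g 0 0 • X e + g 1 0 • Y e := by
  simp [actFree_gen, actGen, cls_single, X, Y]

lemma actFree_y (g : SL2) (e : Edge n) :
    actFree g (Free.gen (Gen.y e)) = g 0 1 • X e + g 1 1 • Y e := by
  simp [actFree_gen, actGen, cls_single, X, Y]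

lemma actFree_w (g : SL2) (e : Edge n) : actFree g (Free.gen (Gen.w e)) = W e := by
  simp [actFree_gen, actGen, cls_single, W]

lemma actFree_rel (g : SL2) ⦃a b : Free n⦄ (h : Rel n a b) : actFree g a = actFree g b := by
  have key (k : Edge n → ℚ) (hk : IsRelation k) (s t : ℚ) :
      ∑ e, k e • (s • X e + t • Y e) = 0 := by
    simp only [smul_add, Finset.sum_add_distrib, smul_comm _ s, smul_comm _ t, ← Finset.smul_sum,
      lin_X hk, lin_Y hk, smul_zero, add_zero]
  induction h with
  | x_mul_w e =>
    rw [map_mul, actFree_x, actFree_w, add_mul, smul_mul_assoc, smul_mul_assoc, X_mul_W, Y_mul_W]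
    simp
  | y_mul_w e =>
    rw [map_mul, actFree_y, actFree_w, add_mul, smul_mul_assoc, smul_mul_assoc, X_mul_W, Y_mul_W]
    simp
  | arnold i j l hij hjl =>
    simpa only [map_add, map_sub, map_mul, actFree_w, map_zero] using arnold hij hjl
  | lin_x k hk => simpa only [map_sum, map_smul, actFree_x, map_zero] using key k hk _ _
  | lin_y k hk => simpa only [map_sum, map_smul, actFree_y, map_zero] using key k hk _ _

/-- `g` acts on the second page by an algebra homomorphism. -/
def act (g : SL2) : E2Alg n →ₐ[ℚ] E2Alg n :=
  RingQuot.liftAlgHom ℚ ⟨actFree g, actFree_rel g⟩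

lemma act_X (g : SL2) (e : Edge n) : act g (X e) = g 0 0 • X e + g 1 0 • Y e := by
  rw [act, X, gen, RingQuot.liftAlgHom_mkAlgHom_apply, actFree_x]; rfl

lemma act_Y (g : SL2) (e : Edge n) : act g (Y e) = g 0 1 • X e + g 1 1 • Y e := by
  rw [act, Y, gen, RingQuot.liftAlgHom_mkAlgHom_apply, actFree_y]; rfl

lemma act_W (g : SL2) (e : Edge n) : act g (W e) = W e := by
  rw [act, W, gen, RingQuot.liftAlgHom_mkAlgHom_apply, actFree_w]; rfl

lemma act_cls (g : SL2) (m : Gen n →₀ ℚ) :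
    act g (cls m) = cls (Finsupp.linearCombination ℚ (actGen g) m) := by
  simp [cls, act, RingQuot.liftAlgHom_mkAlgHom_apply, actFree]

/-- The representation of `SL₂(ℚ)` on the second page. -/
def rep (n : ℕ) : Representation ℚ SL2 (E2Alg n) where
  toFun g := (act g).toLinearMap
  map_one' := by
    have : act (1 : SL2) = AlgHom.id ℚ (E2Alg n) := by
      apply algHom_ext
      rintro (e | e | e)
      · rw [← X, act_X]; simp
      · rw [← Y, act_Y]; simp
      · rw [← W, act_W]; simp
    rw [this]; rfl
  map_mul' g h := by
    have : act (n := n) (g * h) = (act g).comp (act h) := by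
      apply algHom_ext
      rintro (e | e | e)
      · rw [← X, act_X, AlgHom.comp_apply, act_X, map_add, map_smul, map_smul, act_X, act_Y]
        simp only [Matrix.SpecialLinearGroup.coe_mul, Matrix.mul_apply, Fin.sum_univ_two]
        module
      · rw [← Y, act_Y, AlgHom.comp_apply, act_Y, map_add, map_smul, map_smul, act_X, act_Y]
        simp only [Matrix.SpecialLinearGroup.coe_mul, Matrix.mul_apply, Fin.sum_univ_two]
        module
      · rw [← W, act_W, AlgHom.comp_apply, act_W, act_W]
    rw [this]; rfl

lemma rep_apply (g : SL2) (a : E2Alg n) : rep n g a = act g a := rfl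

lemma X_mul_X (e : Edge n) : X e * X e = 0 := gen_sq _

lemma Y_mul_Y (e : Edge n) : Y e * Y e = 0 := gen_sq _

lemma act_dLin (g : SL2) (m : Gen n →₀ ℚ) :
    act g (dLin m) = dLin (Finsupp.linearCombination ℚ (actGen g) m) := by
  induction m using Finsupp.induction_linear with
  | zero => simp
  | add a b ha hb => simp only [map_add, ha, hb]
  | single a c =>
    cases a with
    | x e => simp only [dLin, Finsupp.linearCombination_single, dGen, actGen, map_smul, map_add,
        smul_zero, map_zero, add_zero]
    | y e => simp only [dLin, Finsupp.linearCombination_single, dGen, actGen, map_smul, map_add,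
        smul_zero, map_zero, add_zero]
    | w e =>
      have hdet : g 0 0 * g 1 1 - g 0 1 * g 1 0 = 1 := by
        rw [← Matrix.det_fin_two, g.det_coe]
      have hYX : Y e * X e = -(X e * Y e) := gen_anticomm _ _
      have : act g (X e * Y e) = X e * Y e := by
        rw [map_mul, act_X, act_Y]
        simp only [add_mul, mul_add, smul_mul_assoc, mul_smul_comm, X_mul_X, Y_mul_Y, hYX]
        calc _ = (g 0 0 * g 1 1 - g 0 1 * g 1 0) • (X e * Y e) := by module
          _ = _ := by rw [hdet, one_smul]
      simp [dLin, actGen, dGen, this]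

/-- The differential is equivariant. -/
lemma d_act (g : SL2) (a : E2Alg n) : d (act g a) = act g (d a) := by
  have := eq_top_of_gen_mul
    (LinearMap.ker (d ∘ₗ (act g).toLinearMap - (act g).toLinearMap ∘ₗ d)) (by simp [d_one]) ?_ a
  · simpa [sub_eq_zero] using this
  intro m a ha
  simp only [LinearMap.mem_ker, LinearMap.sub_apply, LinearMap.comp_apply,
    AlgHom.toLinearMap_apply, sub_eq_zero] at ha ⊢
  rw [map_mul, act_cls, d_cls_mul, d_cls_mul, d_cls, d_cls, ha, map_sub, map_mul, map_mul,
    act_dLin, act_cls]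

lemma V10_le (g : SL2) : (V10 n).map (act g).toLinearMap ≤ V10 n := by
  rw [V10, Submodule.map_span, Submodule.span_le]
  have hX (e : Edge n) : X e ∈ V10 n := Submodule.subset_span (Or.inl ⟨e, rfl⟩)
  have hY (e : Edge n) : Y e ∈ V10 n := Submodule.subset_span (Or.inr ⟨e, rfl⟩)
  rintro _ ⟨_, ⟨e, rfl⟩ | ⟨e, rfl⟩, rfl⟩
  · rw [AlgHom.toLinearMap_apply, act_X]
    exact add_mem (Submodule.smul_mem _ _ (hX e)) (Submodule.smul_mem _ _ (hY e))
  · rw [AlgHom.toLinearMap_apply, act_Y]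
    exact add_mem (Submodule.smul_mem _ _ (hX e)) (Submodule.smul_mem _ _ (hY e))

lemma V01_le (g : SL2) : (V01 n).map (act g).toLinearMap ≤ V01 n := by
  rw [V01, Submodule.map_span, Submodule.span_le]
  rintro _ ⟨_, ⟨e, rfl⟩, rfl⟩
  rw [AlgHom.toLinearMap_apply, act_W]
  exact Submodule.subset_span ⟨e, rfl⟩

lemma E2_invariant (p q : ℕ) (g : SL2) : E2 n p q ≤ (E2 n p q).comap (rep n g) := by
  change _ ≤ Submodule.comap (act g).toLinearMap _
  rw [← Submodule.map_le_iff_le_comap, E2, Submodule.map_mul, Submodule.map_pow,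
    Submodule.map_pow]
  exact mul_le_mul' (pow_le_pow_left' (V10_le g) p) (pow_le_pow_left' (V01_le g) q)

lemma cycles_invariant (p q : ℕ) (g : SL2) :
    cycles n p q ≤ (cycles n p q).comap (rep n g) := by
  rintro a ⟨h1, h2⟩
  refine ⟨E2_invariant p q g h1, ?_⟩
  change d (act g a) = 0
  rw [d_act, show d a = 0 from h2, map_zero]

lemma boundaries_invariant (p q : ℕ) (g : SL2) :
    boundaries n p q ≤ (boundaries n p q).comap (rep n g) := by
  match p with
  | 0 => exact bot_le
  | 1 => exact bot_le
  | p + 2 =>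
    rintro _ ⟨a, ha, rfl⟩
    exact ⟨act g a, E2_invariant p (q + 1) g ha, d_act g a⟩

/-- The representation of `SL₂(ℚ)` on `E₂^{p,q}(M(A_{n-1})/E)`. -/
def E2Rep (n p q : ℕ) : Representation ℚ SL2 (E2 n p q) :=
  (rep n).subrepresentation (E2 n p q) (E2_invariant p q)

/-- The representation of `SL₂(ℚ)` on `E₃^{p,q}(M(A_{n-1})/E)`. -/
def E3Rep (n p q : ℕ) : Representation ℚ SL2 (E3 n p q) :=
  ((rep n).subrepresentation (cycles n p q) (cycles_invariant p q)).quotient _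
    fun g _ ha => boundaries_invariant p q g ha

end Action

/-! ### Multiplicities -/

section Multiplicity

open MvPolynomial

/-- `g` acts on polynomials in two variables by the linear substitution of the variables. -/
def polyAct (g : SL2) : MvPolynomial (Fin 2) ℚ →ₐ[ℚ] MvPolynomial (Fin 2) ℚ :=
  aeval fun j => ∑ i, g i j • MvPolynomial.X i

/-- The representation of `SL₂(ℚ)` on polynomials in two variables. -/
def polyRep : Representation ℚ SL2 (MvPolynomial (Fin 2) ℚ) where
  toFun g := (polyAct g).toLinearMap
  map_one' := by
    have : polyAct 1 = AlgHom.id ℚ _ := by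
      ext j : 1
      simp [polyAct, Matrix.one_apply, ite_smul]
    rw [this]; rfl
  map_mul' g h := by
    have : polyAct (g * h) = (polyAct g).comp (polyAct h) := by
      ext j : 1
      simp only [polyAct, aeval_X, AlgHom.comp_apply, map_add, map_smul, Fin.sum_univ_two,
        Matrix.SpecialLinearGroup.coe_mul, Matrix.mul_apply]
      module
    rw [this]; rfl

lemma homogeneous_invariant (k : ℕ) (g : SL2) :
    homogeneousSubmodule (Fin 2) ℚ k ≤ (homogeneousSubmodule (Fin 2) ℚ k).comap (polyRep g) := by
  intro f hf
  have h : (aeval (fun j => ∑ i, g i j • (MvPolynomial.X i : MvPolynomial (Fin 2) ℚ))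
      f).IsHomogeneous (1 * k) := by
    refine IsHomogeneous.aeval hf _ fun j => ?_
    exact Submodule.sum_mem (homogeneousSubmodule (Fin 2) ℚ 1) fun i _ =>
      Submodule.smul_mem _ _ (isHomogeneous_X ℚ i)
  rw [one_mul] at h
  exact h

/-- The irreducible representation `𝕍 k` of `SL₂(ℚ)` of dimension `k + 1`: homogeneous polynomials
of degree `k` in two variables. -/
def VRep (k : ℕ) : Representation ℚ SL2 (homogeneousSubmodule (Fin 2) ℚ k) :=
  polyRep.subrepresentation _ (homogeneous_invariant k)

/-- The multiplicity of the (absolutely) irreducible representation `𝕍 k` in a finite-dimensional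
completely reducible representation: the dimension of the space of homomorphisms from `𝕍 k`. -/
def multiplicity (k : ℕ) {M : Type*} [AddCommGroup M] [Module ℚ M] (ρ : Representation ℚ SL2 M) :
    ℕ :=
  Module.finrank ℚ (Representation.IntertwiningMap (VRep k) ρ)

/-- `e₂^{p,q}(n, E)_k`, the multiplicity of `𝕍 k` in `E₂^{p,q}(M(A_{n-1})/E)`. -/
def e2 (n p q k : ℕ) : ℕ := multiplicity k (E2Rep n p q)

/-- `e₃^{p,q}(n, E)_k`, the multiplicity of `𝕍 k` in `E₃^{p,q}(M(A_{n-1})/E)`. -/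
def e3 (n p q k : ℕ) : ℕ := multiplicity k (E3Rep n p q)

end Multiplicity

end BraidElliptic

end

/-!
The multiplicity of `𝕍 k` in a representation is the dimension of the space of values which
homomorphisms from `𝕍 k` take at the highest weight vector `X ^ k`
(`multiplicity_eq_finrank`): the translates of this vector span `𝕍 k`, by a Vandermonde argument.
Such values have weight `k` for the torus and are fixed by the upper triangular unipotent group.

In `E₂^{p,1}` the weight `p` is the largest one, and its weight space `TopW` is spanned by the
products `x ⋯ x ω` with `p` factors `x`. Conversely, each of these products is such a value: by
polarization, `L (f) = ((∂ f / ∂ X) x + (∂ f / ∂ Y) y) / deg f` raises the degree of an equivariant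
map from polynomials by one. As the boundaries in `E₂^{p,1}` come from `E₂^{p-2,2}`, their weights
are smaller than `p`, so the highest weight vectors of weight `p` in `E₃^{p,1}` are those of
`TopW ∩ ker d` (`e3_one_eq_finrank`).

In `E₂^{p+2,0}` the vectors of weight `p` are the combinations of products `x ⋯ x y` with `p + 1`
factors `x`, and those fixed by the unipotent element are the kernel of the raising operator
`y ↦ x`. This kernel is exactly `d (TopW)` (`map_d_TopW_eq`): modulo the multiples of the
elements `x i j * y i j = d (ω i j)`, a factor `x v` and a factor `y w` may be exchanged, so
lowering after raising is multiplication by `p + 2` (`lower_mul_sub_mem`). The second formula is therefore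
the rank-nullity theorem for `d` on `TopW`.

It remains to compute dimensions. With `n = m + 1` points, the `x 0 c` for `c ≠ 0` are a basis of
the classes `x`; multiplied by `ω e`, one of them becomes redundant. Hence `TopW` is the direct sum
over `e` of the `p`-th exterior powers of spaces of dimension `m - 1`, and the kernel of the raising
operator has dimension `m * C(m, p + 1) - C(m, p + 2)`. That no further relations hold is seen from
homomorphisms to `2 × 2` matrices over exterior algebras (`detect`), which send `x` to diagonal
matrices `(v, -v)` and a single `ω e`, or the classes `y`, to multiples of the matrix unit at
`(0, 1)`.
-/

noncomputable section

namespace BraidElliptic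

/-! ### Homomorphisms out of `𝕍 k` -/

section Multiplicities

variable {M : Type*} [AddCommGroup M] [Module ℚ M]

/-- A polynomial with coefficients in a rational vector space that vanishes at all rational
points has zero coefficients. -/
lemma eq_zero_of_sum_pow_smul {N : ℕ} {v : ℕ → M}
    (h : ∀ b : ℚ, ∑ j ∈ Finset.range N, b ^ j • v j = 0) {j : ℕ} (hj : j < N) : v j = 0 := by
  rw [← Module.forall_dual_apply_eq_zero_iff ℚ]
  intro φ
  have h0 : (∑ i ∈ Finset.range N, Polynomial.monomial i (φ (v i))) = 0 := by
    refine Polynomial.funext fun b => ?_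
    have := congrArg φ (h b)
    rw [map_sum, map_zero] at this
    simpa [Polynomial.eval_finsetSum, mul_comm] using this
  have := congrArg (Polynomial.coeff · j) h0
  simpa [Polynomial.finsetSum_coeff, Polynomial.coeff_monomial, hj] using this

/-- The powers `(X + b Y) ^ k` span the homogeneous polynomials of degree `k`. -/
lemma eq_zero_of_forall_linear_pow {k : ℕ} {D : MvPolynomial (Fin 2) ℚ →ₗ[ℚ] M}
    (h : ∀ b : ℚ, D ((MvPolynomial.X 0 + b • MvPolynomial.X 1) ^ k) = 0)
    {f : MvPolynomial (Fin 2) ℚ} (hf : f.IsHomogeneous k) : D f = 0 := by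
  have key : ∀ j, j < k + 1 → D (MvPolynomial.X 0 ^ (k - j) * MvPolynomial.X 1 ^ j) = 0 := by
    intro j hj
    have h1 : ∀ b : ℚ, ∑ i ∈ Finset.range (k + 1),
        b ^ i • ((k.choose i : ℚ) • D (MvPolynomial.X 0 ^ (k - i) * MvPolynomial.X 1 ^ i)) = 0 := by
      intro b
      rw [← h b, add_comm (MvPolynomial.X 0), add_pow, map_sum]
      refine Finset.sum_congr rfl fun i _ => ?_
      rw [← map_smul, ← map_smul, smul_pow]
      congr 1
      simp only [MvPolynomial.smul_eq_C_mul, map_natCast]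
      ring
    have h2 := eq_zero_of_sum_pow_smul h1 hj
    exact (smul_eq_zero.1 h2).resolve_left
      (by exact_mod_cast (Nat.choose_pos (Nat.lt_succ_iff.1 hj)).ne')
  rw [f.as_sum, map_sum]
  refine Finset.sum_eq_zero fun s hs => ?_
  have hs' := hf (MvPolynomial.mem_support_iff.1 hs)
  have hdeg : s 0 + s 1 = k := by
    rw [← hs', Finsupp.weight_apply, Finsupp.sum_fintype _ _ (by simp)]
    simp [Fin.sum_univ_two]
  have : MvPolynomial.monomial s (MvPolynomial.coeff s f)
      = MvPolynomial.coeff s f • (MvPolynomial.X 0 ^ (k - s 1) * MvPolynomial.X 1 ^ s 1) := by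
    rw [MvPolynomial.monomial_eq, Finsupp.prod_fintype _ _ (by simp), Fin.prod_univ_two,
      MvPolynomial.smul_eq_C_mul, show k - s 1 = s 0 by omega]
  rw [this, map_smul, key _ (by omega), smul_zero]

/-- The highest weight vector `X ^ k` of `𝕍 k`. -/
def topVec (k : ℕ) : MvPolynomial.homogeneousSubmodule (Fin 2) ℚ k :=
  ⟨MvPolynomial.X 0 ^ k, by
    simpa using (MvPolynomial.isHomogeneous_X ℚ (0 : Fin 2)).pow k⟩

/-- The lower triangular unipotent element `X ↦ X + b Y`. -/
def lowerUnip (b : ℚ) : SL2 := ⟨!![1, 0; b, 1], by simp⟩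

/-- The upper triangular unipotent element `Y ↦ X + Y`. -/
def upperUnip : SL2 := ⟨!![1, 1; 0, 1], by simp⟩

/-- The element `X ↦ 2 X`, `Y ↦ Y / 2` of the diagonal torus. -/
def torusElt : SL2 := ⟨!![2, 0; 0, 1 / 2], by simp⟩

lemma polyAct_X_zero (g : SL2) : polyAct g (MvPolynomial.X 0)
    = g 0 0 • MvPolynomial.X 0 + g 1 0 • MvPolynomial.X 1 := by
  simp [polyAct]

lemma polyAct_lowerUnip (b : ℚ) : polyAct (lowerUnip b) (MvPolynomial.X 0)
    = MvPolynomial.X 0 + b • MvPolynomial.X 1 := by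
  rw [polyAct_X_zero]
  simp [lowerUnip]

lemma coe_VRep_topVec (k : ℕ) (g : SL2) : (VRep k g (topVec k) : MvPolynomial (Fin 2) ℚ)
    = (g 0 0 • MvPolynomial.X 0 + g 1 0 • MvPolynomial.X 1) ^ k := by
  rw [← polyAct_X_zero, ← map_pow]
  rfl

lemma VRep_upperUnip_topVec (k : ℕ) : VRep k upperUnip (topVec k) = topVec k := by
  apply Subtype.ext
  rw [coe_VRep_topVec]
  simp [upperUnip, topVec]

lemma VRep_torusElt_topVec (k : ℕ) : VRep k torusElt (topVec k) = (2 : ℚ) ^ k • topVec k := by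
  apply Subtype.ext
  rw [coe_VRep_topVec]
  simp [torusElt, topVec, smul_pow]

/-- A homomorphism out of `𝕍 k` is determined by its value at the highest weight vector, since
the translates of this vector span. -/
lemma intertwiningMap_eq_zero {k : ℕ} {ρ : Representation ℚ SL2 M}
    (φ : Representation.IntertwiningMap (VRep k) ρ) (h : φ (topVec k) = 0) : φ = 0 := by
  obtain ⟨D, hD⟩ := LinearMap.exists_extend φ.toLinearMap
  have hD' (f : MvPolynomial.homogeneousSubmodule (Fin 2) ℚ k) : D f = φ f :=
    LinearMap.congr_fun hD f
  refine Representation.IntertwiningMap.ext (LinearMap.ext fun f => ?_)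
  refine (hD' f).symm.trans (eq_zero_of_forall_linear_pow (k := k) (fun b => ?_) f.2)
  have h2 := hD' (VRep k (lowerUnip b) (topVec k))
  rw [φ.isIntertwining, h, map_zero] at h2
  rw [← h2]
  rw [← polyAct_lowerUnip, ← map_pow]
  rfl

/-- The multiplicity of `𝕍 k` is the dimension of the space of possible values at the highest
weight vector. -/
lemma multiplicity_eq_finrank {k : ℕ} {ρ : Representation ℚ SL2 M} {S : Submodule ℚ M}
    (h1 : ∀ φ : Representation.IntertwiningMap (VRep k) ρ, φ (topVec k) ∈ S)
    (h2 : ∀ a ∈ S, ∃ φ : Representation.IntertwiningMap (VRep k) ρ, φ (topVec k) = a) :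
    multiplicity k ρ = Module.finrank ℚ S := by
  let ev : Representation.IntertwiningMap (VRep k) ρ →ₗ[ℚ] M :=
    { toFun := fun φ => φ (topVec k)
      map_add' := fun _ _ => rfl
      map_smul' := fun _ _ => rfl }
  have hinj : Function.Injective ev :=
    (injective_iff_map_eq_zero ev).2 fun φ h => intertwiningMap_eq_zero φ h
  have hrange : LinearMap.range ev = S := by
    apply le_antisymm
    · rintro _ ⟨φ, rfl⟩
      exact h1 φ
    · intro a ha
      exact h2 a ha
  rw [multiplicity, ← hrange, LinearMap.finrank_range_of_inj hinj]

end Multiplicities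

/-! ### Weights -/

section Weights

variable {M : Type*} [AddCommGroup M] [Module ℚ M] {f : Module.End ℚ M}

lemma aeval_prod_eq_zero {s : Finset ℚ} {a : M}
    (ha : a ∈ ⨆ μ ∈ s, Module.End.eigenspace f μ) :
    Polynomial.aeval f (∏ μ ∈ s, (Polynomial.X - Polynomial.C μ)) a = 0 := by
  suffices h : (⨆ μ ∈ s, Module.End.eigenspace f μ)
      ≤ LinearMap.ker (Polynomial.aeval f (∏ μ ∈ s, (Polynomial.X - Polynomial.C μ))) from h ha
  refine iSup₂_le fun μ hμ b hb => ?_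
  rw [LinearMap.mem_ker, Module.End.aeval_apply_of_mem_apply_eq_smul
    (Module.End.mem_eigenspace_iff.1 hb), Polynomial.eval_prod, Finset.prod_eq_zero hμ (by simp),
    zero_smul]

lemma eval_prod_ne_zero {s : Finset ℚ} {c : ℚ} (hc : c ∉ s) :
    (∏ μ ∈ s, (Polynomial.X - Polynomial.C μ)).eval c ≠ 0 := by
  rw [Polynomial.eval_prod, Finset.prod_ne_zero_iff]
  intro μ hμ
  simpa [sub_eq_zero] using fun h : c = μ => hc (h ▸ hμ)

lemma eq_zero_of_mem_eigenspaces {s : Finset ℚ} {c : ℚ} (hc : c ∉ s) {a : M} (h : f a = c • a)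
    (ha : a ∈ ⨆ μ ∈ s, Module.End.eigenspace f μ) : a = 0 := by
  have h1 := aeval_prod_eq_zero ha
  rw [Module.End.aeval_apply_of_mem_apply_eq_smul h] at h1
  exact (smul_eq_zero.1 h1).resolve_left (eval_prod_ne_zero hc)

/-- If `a` is a sum of a vector of weight `c` and of vectors of other weights, and `a` has weight
`c` modulo an invariant subspace, then `a` is a vector of weight `c` modulo this subspace. -/
lemma mem_sup_of_weight {s : Finset ℚ} {c : ℚ} (hc : c ∉ s) {T B : Submodule ℚ M}
    (hT : T ≤ Module.End.eigenspace f c) (hB : B ≤ B.comap f) {a : M}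
    (ha : a ∈ T ⊔ ⨆ μ ∈ s, Module.End.eigenspace f μ) (hfa : f a - c • a ∈ B) : a ∈ T ⊔ B := by
  set Q : Polynomial ℚ := ∏ μ ∈ s, (Polynomial.X - Polynomial.C μ) with hQ
  have hQc : Q.eval c ≠ 0 := eval_prod_ne_zero hc
  obtain ⟨b, hb, z, hz, rfl⟩ := Submodule.mem_sup.1 ha
  -- `Q (f)` kills the other weights, so that it maps `b + z` to a multiple of `b`
  have h1 : Polynomial.aeval f Q (b + z) = Q.eval c • b := by
    rw [map_add, hQ, aeval_prod_eq_zero hz, add_zero,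
      Module.End.aeval_apply_of_mem_apply_eq_smul (Module.End.mem_eigenspace_iff.1 (hT hb))]
  -- while `Q (f) - Q (c)` is divisible by `f - c`
  obtain ⟨R, hR⟩ : Polynomial.X - Polynomial.C c ∣ Q - Polynomial.C (Q.eval c) := by
    rw [Polynomial.dvd_iff_isRoot]
    simp
  have h2 : Polynomial.aeval f Q (b + z) - Q.eval c • (b + z) ∈ B := by
    have hinv : ∀ R : Polynomial ℚ, ∀ x ∈ B, Polynomial.aeval f R x ∈ B := by
      intro R
      induction R using Polynomial.induction_on' with
      | add p q hp hq =>
        intro x hx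
        rw [map_add]
        exact add_mem (hp x hx) (hq x hx)
      | monomial k r =>
        intro x hx
        rw [Polynomial.aeval_monomial, Module.End.mul_apply, Module.algebraMap_end_apply]
        refine B.smul_mem _ ?_
        induction k with
        | zero => simpa using hx
        | succ k ih =>
          rw [pow_succ', Module.End.mul_apply]
          exact hB ih
    rw [mul_comm] at hR
    have h3 := congrArg (fun P => Polynomial.aeval f P (b + z)) hR
    simp only [map_sub (Polynomial.aeval (R := ℚ) f), map_mul, Polynomial.aeval_C,
      Polynomial.aeval_X, LinearMap.sub_apply, Module.End.mul_apply, Module.algebraMap_end_apply] at h3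
    rw [h3]
    exact hinv R _ hfa
  rw [h1, ← smul_sub] at h2
  have h3 := B.neg_mem ((B.smul_mem_iff hQc).1 h2)
  rw [neg_sub, add_sub_cancel_left] at h3
  exact Submodule.add_mem_sup hb h3

end Weights

/-! ### Weights on the second page -/

section SecondPage

variable {n : ℕ}

/-- The span of the classes `x`. -/
def AX (n : ℕ) : Submodule ℚ (E2Alg n) := Submodule.span ℚ (Set.range X)

/-- The span of the classes `y`. -/
def AY (n : ℕ) : Submodule ℚ (E2Alg n) := Submodule.span ℚ (Set.range Y)

/-- The span of the products of `p` classes `x` and of a class `ω`: the highest weight part of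
`E₂^{p,1}`. -/
def TopW (n p : ℕ) : Submodule ℚ (E2Alg n) := AX n ^ p * V01 n

lemma X_mem_AX (e : Edge n) : X e ∈ AX n := Submodule.subset_span ⟨e, rfl⟩

lemma Y_mem_AY (e : Edge n) : Y e ∈ AY n := Submodule.subset_span ⟨e, rfl⟩

lemma W_mem_V01 (e : Edge n) : W e ∈ V01 n := Submodule.subset_span ⟨e, rfl⟩

lemma V10_eq_sup : V10 n = AX n ⊔ AY n := Submodule.span_union _ _

lemma AX_le_V10 : AX n ≤ V10 n := V10_eq_sup (n := n) ▸ le_sup_left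

lemma AY_le_V10 : AY n ≤ V10 n := V10_eq_sup (n := n) ▸ le_sup_right

lemma V10_le_range_cls : V10 n ≤ LinearMap.range (cls (n := n)) := by
  rw [V10, Submodule.span_le]
  rintro _ (⟨e, rfl⟩ | ⟨e, rfl⟩) <;> exact ⟨_, rfl⟩

lemma mul_self_of_mem_AX {a : E2Alg n} (ha : a ∈ AX n) : a * a = 0 := by
  obtain ⟨v, rfl⟩ := V10_le_range_cls (AX_le_V10 ha)
  exact cls_sq v

lemma mul_anticomm_of_mem_V10 {a b : E2Alg n} (ha : a ∈ V10 n) (hb : b ∈ V10 n) :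
    a * b = -(b * a) := by
  obtain ⟨v, rfl⟩ := V10_le_range_cls ha
  obtain ⟨w, rfl⟩ := V10_le_range_cls hb
  exact cls_anticomm v w

lemma commute_of_le_V10 {S T : Submodule ℚ (E2Alg n)} (hS : S ≤ V10 n) (hT : T ≤ V10 n) :
    Commute S T := by
  apply le_antisymm <;> rw [Submodule.mul_le]
  · intro a ha b hb
    rw [mul_anticomm_of_mem_V10 (hS ha) (hT hb)]
    exact Submodule.neg_mem _ (Submodule.mul_mem_mul hb ha)
  · intro a ha b hb
    rw [mul_anticomm_of_mem_V10 (hT ha) (hS hb)]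
    exact Submodule.neg_mem _ (Submodule.mul_mem_mul hb ha)

lemma commute_AX_AY : Commute (AX n) (AY n) := commute_of_le_V10 AX_le_V10 AY_le_V10

lemma V10_pow_le (p : ℕ) :
    V10 n ^ p ≤ ⨆ k ∈ Finset.range (p + 1), AX n ^ (p - k) * AY n ^ k := by
  rw [V10_eq_sup, sup_comm, ← Submodule.add_eq_sup, (commute_AX_AY (n := n)).symm.add_pow]
  have hsum : ∀ (s : Finset ℕ) (F : ℕ → Submodule ℚ (E2Alg n)), ∑ k ∈ s, F k = ⨆ k ∈ s, F k := by
    intro s F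
    rw [← Finset.sup_eq_iSup]
    rfl
  rw [hsum]
  -- the semiring of submodules is idempotent, so that the binomial coefficients are `1` in it
  refine iSup₂_mono fun k hk => ?_
  rw [natCast_eq_one (Nat.choose_pos (Nat.lt_succ_iff.1 (Finset.mem_range.1 hk))).ne', mul_one]
  exact le_of_eq ((commute_AX_AY (n := n)).symm.pow_pow k (p - k))

/-- The subspace of weight `μ` for the chosen element of the torus. -/
abbrev Wt (n : ℕ) (μ : ℚ) : Submodule ℚ (E2Alg n) :=
  Module.End.eigenspace (act torusElt).toLinearMap μ

lemma mem_Wt {μ : ℚ} {a : E2Alg n} : a ∈ Wt n μ ↔ act torusElt a = μ • a :=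
  Module.End.mem_eigenspace_iff

lemma Wt_mul_Wt (μ ν : ℚ) : Wt n μ * Wt n ν ≤ Wt n (μ * ν) := by
  rw [Submodule.mul_le]
  intro a ha b hb
  rw [mem_Wt] at *
  rw [map_mul, ha, hb, smul_mul_smul_comm]

lemma pow_le_Wt {S : Submodule ℚ (E2Alg n)} {μ : ℚ} (h : S ≤ Wt n μ) (k : ℕ) :
    S ^ k ≤ Wt n (μ ^ k) := by
  induction k with
  | zero =>
    intro a ha
    rw [pow_zero, Submodule.mem_one] at ha
    obtain ⟨c, rfl⟩ := ha
    rw [mem_Wt, AlgHom.commutes, pow_zero, one_smul]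
  | succ k ih =>
    rw [pow_succ, pow_succ]
    exact (mul_le_mul' ih h).trans (Wt_mul_Wt _ _)

lemma AX_le_Wt : AX n ≤ Wt n 2 := by
  rw [AX, Submodule.span_le]
  rintro _ ⟨e, rfl⟩
  rw [SetLike.mem_coe, mem_Wt, act_X]
  simp [torusElt]

lemma AY_le_Wt : AY n ≤ Wt n (1 / 2) := by
  rw [AY, Submodule.span_le]
  rintro _ ⟨e, rfl⟩
  rw [SetLike.mem_coe, mem_Wt, act_Y]
  simp [torusElt]

lemma V01_le_Wt : V01 n ≤ Wt n 1 := by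
  rw [V01, Submodule.span_le]
  rintro _ ⟨e, rfl⟩
  rw [SetLike.mem_coe, mem_Wt, act_W, one_smul]

lemma AX_pow_mul_AY_pow_le_Wt (p q k : ℕ) (hk : k ≤ p) :
    AX n ^ (p - k) * AY n ^ k * V01 n ^ q ≤ Wt n (2 ^ p / 4 ^ k) := by
  have h := (mul_le_mul' ((mul_le_mul' (pow_le_Wt AX_le_Wt (p - k)) (pow_le_Wt AY_le_Wt k)).trans
    (Wt_mul_Wt _ _)) (pow_le_Wt (V01_le_Wt (n := n)) q)).trans (Wt_mul_Wt _ _)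
  refine h.trans (le_of_eq ?_)
  congr 1
  rw [one_pow, mul_one, show (4 : ℚ) = 2 * 2 by norm_num, mul_pow, one_div, inv_pow]
  conv_rhs => rw [← Nat.sub_add_cancel hk, pow_add]
  field_simp

/-- The weights of `E₂^{p,q}` are `2 ^ (p - 2 k)`, for `k ≤ p`. -/
lemma E2_le_iSup (p q : ℕ) :
    E2 n p q ≤ ⨆ k ∈ Finset.range (p + 1), AX n ^ (p - k) * AY n ^ k * V01 n ^ q := by
  refine (mul_le_mul_left (V10_pow_le p) _).trans ?_
  simp only [Submodule.iSup_mul]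
  exact le_rfl

lemma weight_injective (p : ℕ) : Function.Injective fun k : ℕ => (2 : ℚ) ^ p / 4 ^ k := by
  intro k l h
  have h2 : (2 : ℚ) ^ p ≠ 0 := by positivity
  simp only [div_eq_mul_inv, mul_right_inj' h2, inv_inj] at h
  exact Nat.pow_right_injective (le_refl 2 |>.trans (by norm_num : 2 ≤ 4)) (by exact_mod_cast h)

/-- The weights of `E₂^{p,q}` other than the one of index `k₀`. -/
def otherWeights (p k₀ : ℕ) : Finset ℚ :=
  ((Finset.range (p + 1)).erase k₀).image fun k => (2 : ℚ) ^ p / 4 ^ k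

lemma notMem_otherWeights (p k₀ : ℕ) : (2 : ℚ) ^ p / 4 ^ k₀ ∉ otherWeights p k₀ := by
  rw [otherWeights, Finset.mem_image]
  rintro ⟨k, hk, h⟩
  exact Finset.ne_of_mem_erase hk (weight_injective p h)

lemma E2_le_sup (p q k₀ : ℕ) :
    E2 n p q ≤ AX n ^ (p - k₀) * AY n ^ k₀ * V01 n ^ q ⊔ ⨆ μ ∈ otherWeights p k₀, Wt n μ := by
  refine (E2_le_iSup p q).trans (iSup₂_le fun k hk => ?_)
  by_cases h : k = k₀
  · subst h
    exact le_sup_left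
  · refine le_trans ?_ le_sup_right
    refine le_trans (AX_pow_mul_AY_pow_le_Wt p q k (Nat.lt_succ_iff.1 (Finset.mem_range.1 hk))) ?_
    exact le_iSup₂_of_le (f := fun μ _ => Wt n μ) _
      (Finset.mem_image.2 ⟨k, Finset.mem_erase.2 ⟨h, hk⟩, rfl⟩) le_rfl

lemma TopW_le_Wt (p : ℕ) : TopW n p ≤ Wt n (2 ^ p) := by
  simpa [TopW] using AX_pow_mul_AY_pow_le_Wt (n := n) p 1 0 (Nat.zero_le p)

lemma TopW_le_E2 (p : ℕ) : TopW n p ≤ E2 n p 1 := by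
  rw [E2, pow_one]
  exact mul_le_mul_left (pow_le_pow_left' AX_le_V10 p) _

/-- All weights of the boundaries in `E₂^{p,1}` are less than `2 ^ p`. -/
lemma boundaries_le_otherWeights (p : ℕ) :
    boundaries n p 1 ≤ ⨆ μ ∈ otherWeights p 0, Wt n μ := by
  match p with
  | 0 => exact bot_le
  | 1 => exact bot_le
  | p + 2 =>
    rw [boundaries, Submodule.map_le_iff_le_comap]
    refine (E2_le_iSup p 2).trans (iSup₂_le fun k hk => ?_)
    rw [← Submodule.map_le_iff_le_comap]
    rintro _ ⟨a, ha, rfl⟩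
    have hk' := Nat.lt_succ_iff.1 (Finset.mem_range.1 hk)
    have h1 := mem_Wt.1 (AX_pow_mul_AY_pow_le_Wt p 2 k hk' ha)
    refine Submodule.mem_iSup_of_mem _ (Submodule.mem_iSup_of_mem
      (Finset.mem_image.2 ⟨k + 1, Finset.mem_erase.2 ⟨by omega, Finset.mem_range.2 (by omega)⟩,
        rfl⟩) ?_)
    rw [mem_Wt, ← d_act, h1, map_smul]
    congr 1
    rw [pow_add, pow_succ (4 : ℚ)]
    field_simp
    norm_num

end SecondPage

/-! ### Highest weight vectors -/

section HighestWeight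

variable {n : ℕ}

/-- The chain rule for a linear substitution. -/
lemma pderiv_polyAct (g : SL2) (i : Fin 2) (f : MvPolynomial (Fin 2) ℚ) :
    MvPolynomial.pderiv i (polyAct g f)
      = ∑ j, g i j • polyAct g (MvPolynomial.pderiv j f) := by
  induction f using MvPolynomial.induction_on with
  | C r => simp [polyAct]
  | add a b ha hb => simp only [map_add, ha, hb, smul_add, Finset.sum_add_distrib]
  | mul_X a k ha =>
    have hk : MvPolynomial.pderiv i (polyAct g (MvPolynomial.X k)) = MvPolynomial.C (g i k) := by
      simp only [polyAct, MvPolynomial.aeval_X, map_sum, MvPolynomial.smul_eq_C_mul]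
      fin_cases i <;> simp
    have hX : ∀ j, polyAct g (MvPolynomial.pderiv j (MvPolynomial.X k))
        = if j = k then 1 else 0 := by
      intro j
      rw [MvPolynomial.pderiv_X, Pi.single_apply]
      by_cases h : j = k
      · simp [h]
      · simp [h, Ne.symm h]
    simp only [map_mul, Derivation.leibniz, smul_eq_mul, ha, hk, map_add, hX, Finset.mul_sum,
      smul_add, Finset.sum_add_distrib, mul_ite, mul_one, mul_zero, smul_ite, smul_zero,
      Finset.sum_ite_eq', Finset.mem_univ, if_true, mul_smul_comm]
    congr 1
    rw [MvPolynomial.smul_eq_C_mul, mul_comm]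

/-- The values at `X ^ p` of the equivariant linear maps from polynomials to the second page. -/
def equivariantValues (n p : ℕ) : Submodule ℚ (E2Alg n) where
  carrier := {a | ∃ L : MvPolynomial (Fin 2) ℚ →ₗ[ℚ] E2Alg n,
    (∀ g f, L (polyAct g f) = act g (L f)) ∧ L (MvPolynomial.X 0 ^ p) = a}
  zero_mem' := ⟨0, by simp, rfl⟩
  add_mem' := by
    rintro _ _ ⟨L, hL, rfl⟩ ⟨L', hL', rfl⟩
    exact ⟨L + L', by simp [hL, hL'], rfl⟩
  smul_mem' := by
    rintro c _ ⟨L, hL, rfl⟩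
    exact ⟨c • L, by simp [hL], rfl⟩

lemma X_mul_mem_equivariantValues (e : Edge n) {p : ℕ} {a : E2Alg n}
    (ha : a ∈ equivariantValues n p) : X e * a ∈ equivariantValues n (p + 1) := by
  obtain ⟨L, hL, rfl⟩ := ha
  -- polarization: `(∂ f / ∂ X) x + (∂ f / ∂ Y) y`, up to the degree of `f`
  refine ⟨(p + 1 : ℚ)⁻¹ • (LinearMap.mulLeft ℚ (X e) ∘ₗ L ∘ₗ (MvPolynomial.pderiv 0).toLinearMap
    + LinearMap.mulLeft ℚ (Y e) ∘ₗ L ∘ₗ (MvPolynomial.pderiv 1).toLinearMap), ?_, ?_⟩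
  · intro g f
    simp only [LinearMap.smul_apply, LinearMap.add_apply, LinearMap.comp_apply,
      Derivation.coeFn_coe, LinearMap.mulLeft_apply, map_smul,
      map_add, map_mul, act_X, act_Y, pderiv_polyAct, Fin.sum_univ_two, hL, add_mul,
      smul_mul_assoc]
    abel_nf
  · have h : (p + 1 : ℚ) ≠ 0 := by positivity
    have h1 : MvPolynomial.pderiv 0 ((MvPolynomial.X 0 : MvPolynomial (Fin 2) ℚ) ^ (p + 1))
        = (p + 1 : ℚ) • MvPolynomial.X 0 ^ p := by
      rw [MvPolynomial.pderiv_pow, MvPolynomial.smul_eq_C_mul]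
      simp
    have h2 : MvPolynomial.pderiv 1 ((MvPolynomial.X 0 : MvPolynomial (Fin 2) ℚ) ^ (p + 1))
        = 0 := by
      rw [MvPolynomial.pderiv_pow, MvPolynomial.pderiv_X_of_ne (by decide), mul_zero]
    simp only [LinearMap.smul_apply, LinearMap.add_apply, LinearMap.comp_apply,
      Derivation.coeFn_coe, LinearMap.mulLeft_apply, h1, h2,
      map_smul, map_zero, add_zero, smul_smul, inv_mul_cancel₀ h,
      one_smul]

lemma V01_le_equivariantValues : V01 n ≤ equivariantValues n 0 := by
  rw [V01, Submodule.span_le]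
  rintro _ ⟨e, rfl⟩
  refine ⟨(MvPolynomial.aeval fun _ => (0 : ℚ)).toLinearMap.smulRight (W e), ?_, by simp⟩
  intro g f
  have : (MvPolynomial.aeval fun _ => (0 : ℚ)).comp (polyAct g)
      = MvPolynomial.aeval fun _ => (0 : ℚ) := by
    ext j
    simp [polyAct]
  have h := DFunLike.congr_fun this f
  rw [AlgHom.comp_apply] at h
  simp only [LinearMap.smulRight_apply, AlgHom.toLinearMap_apply, h, map_smul, act_W]

lemma TopW_le_equivariantValues (p : ℕ) : TopW n p ≤ equivariantValues n p := by
  induction p with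
  | zero => simpa [TopW] using V01_le_equivariantValues
  | succ p ih =>
    rw [TopW, pow_succ', mul_assoc, Submodule.mul_le]
    intro v hv a ha
    induction hv using Submodule.span_induction with
    | mem v hv =>
      obtain ⟨e, rfl⟩ := hv
      exact X_mul_mem_equivariantValues e (ih ha)
    | zero => simp
    | add v w _ _ hv hw => rw [add_mul]; exact add_mem hv hw
    | smul c v _ hv => rw [smul_mul_assoc]; exact Submodule.smul_mem _ c hv

/-- Every vector of `TopW` is the image of the highest weight vector under a homomorphism from
`𝕍 p`. -/
lemma exists_intertwiningMap {p : ℕ} {a : E2Alg n} (ha : a ∈ TopW n p) :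
    ∃ φ : Representation.IntertwiningMap (VRep p) (E2Rep n p 1),
      (φ (topVec p) : E2Alg n) = a := by
  obtain ⟨L, hL, rfl⟩ := TopW_le_equivariantValues p ha
  have hmem : ∀ f : MvPolynomial.homogeneousSubmodule (Fin 2) ℚ p, L f ∈ E2 n p 1 := by
    intro f
    have := eq_zero_of_forall_linear_pow (k := p) (D := (E2 n p 1).mkQ ∘ₗ L) (fun b => ?_) f.2
    · simpa using this
    · rw [← polyAct_lowerUnip, ← map_pow, LinearMap.comp_apply, hL, Submodule.mkQ_apply,
        Submodule.Quotient.mk_eq_zero]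
      exact E2_invariant p 1 _ (TopW_le_E2 p ha)
  refine ⟨⟨(L ∘ₗ Submodule.subtype _).codRestrict _ hmem, fun g => ?_⟩, rfl⟩
  ext f
  exact hL g f

end HighestWeight

/-! ### Multiplicities as dimensions of spaces of highest weight vectors -/

section MultiplicityFormulas

variable {n : ℕ}

/-- A vector of `E₂^{p,1}` of weight `p` modulo `B` lies in `TopW` modulo `B`. -/
lemma mem_TopW_sup {p : ℕ} {a : E2Alg n} (ha : a ∈ E2 n p 1) {B : Submodule ℚ (E2Alg n)}
    (hB : ∀ b ∈ B, act torusElt b ∈ B) (h : act torusElt a - (2 : ℚ) ^ p • a ∈ B) :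
    a ∈ TopW n p ⊔ B := by
  have h1 := notMem_otherWeights p 0
  have h2 := E2_le_sup p 1 0 ha
  simp only [pow_zero, div_one, Nat.sub_zero, mul_one, pow_one] at h1 h2
  exact mem_sup_of_weight h1 (TopW_le_Wt p) hB h2 h

lemma torusElt_topVec {k : ℕ} {M : Type*} [AddCommGroup M] [Module ℚ M]
    {ρ : Representation ℚ SL2 M} (φ : Representation.IntertwiningMap (VRep k) ρ) :
    ρ torusElt (φ (topVec k)) = (2 : ℚ) ^ k • φ (topVec k) := by
  rw [← φ.isIntertwining, VRep_torusElt_topVec, map_smul]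

lemma upperUnip_topVec {k : ℕ} {M : Type*} [AddCommGroup M] [Module ℚ M]
    {ρ : Representation ℚ SL2 M} (φ : Representation.IntertwiningMap (VRep k) ρ) :
    ρ upperUnip (φ (topVec k)) = φ (topVec k) := by
  rw [← φ.isIntertwining, VRep_upperUnip_topVec]

lemma e2_one_eq_finrank (n p : ℕ) : e2 n p 1 p = Module.finrank ℚ (TopW n p) := by
  rw [e2, multiplicity_eq_finrank (S := (TopW n p).comap (E2 n p 1).subtype),
    (Submodule.comapSubtypeEquivOfLe (TopW_le_E2 p)).finrank_eq]
  · intro φ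
    have h := congrArg Subtype.val (torusElt_topVec φ)
    have := mem_TopW_sup (φ (topVec p)).2 (B := ⊥) (by simp) (by
      rw [Submodule.mem_bot, sub_eq_zero]
      exact h)
    simpa using this
  · intro a ha
    obtain ⟨φ, hφ⟩ := exists_intertwiningMap ha
    exact ⟨φ, Subtype.ext hφ⟩

/-- A space `T` of vectors of weight `k` in a subrepresentation `C` computes the multiplicity of
`𝕍 k` in the subquotient `C / B` if it is a complement to `B` among the vectors which have weight
`k` modulo `B`. -/
lemma multiplicity_subquotient {A : Type*} [AddCommGroup A] [Module ℚ A]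
    {ρ : Representation ℚ SL2 A} {k : ℕ} {B C T : Submodule ℚ A}
    (hC : ∀ g, C ≤ C.comap (ρ g))
    (hB : ∀ g, B.submoduleOf C ≤ (B.submoduleOf C).comap (ρ.subrepresentation C hC g))
    (hTC : T ≤ C) (hTB : ∀ a ∈ T, a ∈ B → a = 0)
    (hw : ∀ a ∈ C, ρ torusElt a - (2 : ℚ) ^ k • a ∈ B → a ∈ T ⊔ B)
    (hT : ∀ a ∈ T, ∃ φ : Representation.IntertwiningMap (VRep k) ρ,
      (∀ f, φ f ∈ C) ∧ φ (topVec k) = a) :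
    multiplicity k ((ρ.subrepresentation C hC).quotient (B.submoduleOf C) hB)
      = Module.finrank ℚ T := by
  let κ : T →ₗ[ℚ] C ⧸ B.submoduleOf C := Submodule.mkQ _ ∘ₗ Submodule.inclusion hTC
  have hκ : Function.Injective κ := by
    rw [injective_iff_map_eq_zero]
    intro a ha
    exact Subtype.ext (hTB a a.2 ((Submodule.Quotient.mk_eq_zero (B.submoduleOf C)).1 ha))
  rw [multiplicity_eq_finrank (S := LinearMap.range κ), LinearMap.finrank_range_of_inj hκ]
  · intro φ
    obtain ⟨a, ha⟩ := Submodule.Quotient.mk_surjective _ (φ (topVec k))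
    have h := torusElt_topVec φ
    rw [← ha] at h
    have h1 : ρ torusElt (a : A) - (2 : ℚ) ^ k • (a : A) ∈ B :=
      (Submodule.Quotient.eq (B.submoduleOf C)).1 h
    obtain ⟨b, hb, z, hz, hbz⟩ := Submodule.mem_sup.1 (hw a a.2 h1)
    refine ⟨⟨b, hb⟩, ?_⟩
    rw [← ha]
    refine (Submodule.Quotient.eq (B.submoduleOf C)).2 ?_
    change b - (a : A) ∈ B
    rw [← hbz, sub_add_cancel_left]
    exact Submodule.neg_mem _ hz
  · rintro _ ⟨⟨a, ha⟩, rfl⟩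
    obtain ⟨φ, hφ, rfl⟩ := hT a ha
    refine ⟨⟨Submodule.mkQ _ ∘ₗ φ.toLinearMap.codRestrict C hφ, fun g => ?_⟩, rfl⟩
    refine LinearMap.ext fun f => congrArg (Submodule.mkQ _) (Subtype.ext ?_)
    exact φ.isIntertwining _ _ g f

/-- The highest weight vectors of `E₃^{p,1}` lift uniquely to cycles, since the boundaries have
smaller weights. -/
lemma e3_one_eq_finrank (n p : ℕ) :
    e3 n p 1 p = Module.finrank ℚ (TopW n p ⊓ LinearMap.ker d : Submodule ℚ (E2Alg n)) := by
  refine multiplicity_subquotient (ρ := rep n) (cycles_invariant p 1) _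
    (inf_le_inf_right _ (TopW_le_E2 p)) (fun a ha hb => ?_) (fun a ha hw => ?_) (fun a ha => ?_)
  · have h := notMem_otherWeights p 0
    rw [pow_zero, div_one] at h
    exact eq_zero_of_mem_eigenspaces h (mem_Wt.1 (TopW_le_Wt p ha.1))
      (boundaries_le_otherWeights p hb)
  · obtain ⟨b, hb, z, hz, hbz⟩ := Submodule.mem_sup.1
      (mem_TopW_sup ha.1 (boundaries_invariant p 1 torusElt) hw)
    have h1 : d a = 0 := ha.2
    have h2 : d z = 0 := (boundaries_le_cycles p 1 hz).2
    have h3 : d b = 0 := by rw [eq_sub_of_add_eq hbz, map_sub, h1, h2, sub_zero]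
    exact Submodule.mem_sup.2 ⟨b, ⟨hb, h3⟩, z, hz, hbz⟩
  · obtain ⟨ha1, ha2⟩ := ha
    obtain ⟨φ, rfl⟩ := exists_intertwiningMap ha1
    let ι : Representation.IntertwiningMap (VRep p) (rep n) :=
      ⟨(E2 n p 1).subtype ∘ₗ φ.toLinearMap, fun g => LinearMap.ext fun f => by
        have h := congrArg Subtype.val (φ.isIntertwining _ _ g f)
        exact h⟩
    let ψ : Representation.IntertwiningMap (VRep p) (rep n) :=
      ⟨d ∘ₗ ι.toLinearMap, fun g => LinearMap.ext fun f => by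
        have h := congrArg d (ι.isIntertwining _ _ g f)
        exact h.trans (d_act g _)⟩
    have hψ : ψ = 0 := intertwiningMap_eq_zero ψ ha2
    exact ⟨ι, fun f => ⟨(φ f).2, DFunLike.congr_fun hψ f⟩, rfl⟩

/-- The multiplicity in `E₂^{p+2,0}`, if all vectors of `E₂^{p+2,0}` of weight `p` which are fixed
by the upper triangular unipotent element are boundaries of highest weight vectors. -/
lemma e2_zero_eq_finrank (n p : ℕ)
    (h : ∀ a ∈ AX n ^ (p + 1) * AY n, act upperUnip a = a → a ∈ (TopW n p).map d) :
    e2 n (p + 2) 0 p = Module.finrank ℚ ((TopW n p).map d) := by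
  have hle : (TopW n p).map d ≤ E2 n (p + 2) 0 :=
    (Submodule.map_mono (TopW_le_E2 p)).trans (d_E2 p 0)
  rw [e2, multiplicity_eq_finrank (S := ((TopW n p).map d).comap (E2 n (p + 2) 0).subtype),
    (Submodule.comapSubtypeEquivOfLe hle).finrank_eq]
  · intro φ
    have h1 := E2_le_sup (p + 2) 0 1 (φ (topVec p)).2
    have h2 := notMem_otherWeights (p + 2) 1
    have hw : (2 : ℚ) ^ (p + 2) / 4 ^ 1 = 2 ^ p := by rw [pow_add]; norm_num
    have h3 := AX_pow_mul_AY_pow_le_Wt (n := n) (p + 2) 0 1 (by omega)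
    rw [hw] at h2 h3
    have h4 := congrArg Subtype.val (torusElt_topVec φ)
    have h5 := mem_sup_of_weight h2 h3 (B := ⊥) (by simp) h1 (by
      rw [Submodule.mem_bot, sub_eq_zero]
      exact h4)
    refine h _ ?_ (congrArg Subtype.val (upperUnip_topVec φ))
    simpa using h5
  · rintro ⟨_, _⟩ ⟨a, ha, rfl⟩
    obtain ⟨φ, rfl⟩ := exists_intertwiningMap ha
    have hmem (f) : d (φ f : E2Alg n) ∈ E2 n (p + 2) 0 := d_E2 p 0 ⟨_, (φ f).2, rfl⟩
    refine ⟨⟨(d ∘ₗ (E2 n p 1).subtype ∘ₗ φ.toLinearMap).codRestrict _ hmem, fun g => ?_⟩, rfl⟩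
    refine LinearMap.ext fun f => Subtype.ext ?_
    have h := congrArg Subtype.val (φ.isIntertwining _ _ g f)
    exact (congrArg d h).trans (d_act g _)

end MultiplicityFormulas

/-! ### Coordinates on the second page -/

section Coordinates

variable {m : ℕ}

/-- The class `x` of the divisor `P 0 = P c`, which is zero for `c = 0`. -/
def ptX (c : Fin (m + 1)) : E2Alg (m + 1) := if h : 0 < c then X (edge 0 c h) else 0

/-- The class `y` of the divisor `P 0 = P c`, which is zero for `c = 0`. -/
def ptY (c : Fin (m + 1)) : E2Alg (m + 1) := if h : 0 < c then Y (edge 0 c h) else 0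

lemma X_eq_sub (e : Edge (m + 1)) : X e = ptX e.1.2 - ptX e.1.1 := by
  have h2 : 0 < e.1.2 := (Fin.zero_le _).trans_lt e.2
  by_cases h1 : 0 < e.1.1
  · rw [ptX, ptX, dif_pos h1, dif_pos h2, X_triangle h1 e.2, add_sub_cancel_left]
    rfl
  · have h0 : e.1.1 = 0 := Fin.le_zero_iff.1 (not_lt.1 h1)
    rw [ptX, ptX, dif_neg h1, dif_pos h2, sub_zero]
    exact congrArg X (Subtype.ext (Prod.ext h0 rfl))

lemma Y_eq_sub (e : Edge (m + 1)) : Y e = ptY e.1.2 - ptY e.1.1 := by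
  have h2 : 0 < e.1.2 := (Fin.zero_le _).trans_lt e.2
  by_cases h1 : 0 < e.1.1
  · rw [ptY, ptY, dif_pos h1, dif_pos h2, Y_triangle h1 e.2, add_sub_cancel_left]
    rfl
  · have h0 : e.1.1 = 0 := Fin.le_zero_iff.1 (not_lt.1 h1)
    rw [ptY, ptY, dif_neg h1, dif_pos h2, sub_zero]
    exact congrArg Y (Subtype.ext (Prod.ext h0 rfl))

lemma ptX_zero : ptX (0 : Fin (m + 1)) = 0 := by simp [ptX]

lemma ptY_zero : ptY (0 : Fin (m + 1)) = 0 := by simp [ptY]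

lemma ptX_mem (c : Fin (m + 1)) : ptX c ∈ AX (m + 1) := by
  rw [ptX]
  split_ifs with h
  · exact X_mem_AX _
  · exact zero_mem _

lemma ptY_mem (c : Fin (m + 1)) : ptY c ∈ AY (m + 1) := by
  rw [ptY]
  split_ifs with h
  · exact Y_mem_AY _
  · exact zero_mem _

/-- The class `∑ v c • x 0 c`. -/
def vecX (s : Finset (Fin (m + 1))) : (s → ℚ) →ₗ[ℚ] E2Alg (m + 1) :=
  Fintype.linearCombination ℚ fun c : s => ptX (c : Fin (m + 1))

/-- The class `∑ v c • y 0 c`. -/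
def vecY (s : Finset (Fin (m + 1))) : (s → ℚ) →ₗ[ℚ] E2Alg (m + 1) :=
  Fintype.linearCombination ℚ fun c : s => ptY (c : Fin (m + 1))

variable (s : Finset (Fin (m + 1)))

lemma vecX_single (c : s) : vecX s (Pi.single c 1) = ptX (c : Fin (m + 1)) := by
  simp [vecX, Fintype.linearCombination_apply_single]

lemma vecY_single (c : s) : vecY s (Pi.single c 1) = ptY (c : Fin (m + 1)) := by
  simp [vecY, Fintype.linearCombination_apply_single]

lemma vecX_mem (v : s → ℚ) : vecX s v ∈ AX (m + 1) := by
  rw [vecX, Fintype.linearCombination_apply]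
  exact Submodule.sum_mem _ fun c _ => Submodule.smul_mem _ _ (ptX_mem _)

lemma vecY_mem (v : s → ℚ) : vecY s v ∈ AY (m + 1) := by
  rw [vecY, Fintype.linearCombination_apply]
  exact Submodule.sum_mem _ fun c _ => Submodule.smul_mem _ _ (ptY_mem _)

/-- The homomorphism from the exterior algebra on the points of `s` that sends the point `c` to
`x 0 c`. -/
def extX : ExteriorAlgebra ℚ (s → ℚ) →ₐ[ℚ] E2Alg (m + 1) :=
  ExteriorAlgebra.lift ℚ ⟨vecX s, fun v => mul_self_of_mem_AX (vecX_mem s v)⟩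

lemma extX_ι (v : s → ℚ) : extX s (ExteriorAlgebra.ι ℚ v) = vecX s v := by
  simp [extX]

lemma map_extX (p : ℕ) : (⋀[ℚ]^p (s → ℚ)).map (extX s).toLinearMap
    = LinearMap.range (vecX s) ^ p := by
  rw [ExteriorAlgebra.exteriorPower, Submodule.map_pow, ← LinearMap.range_comp]
  congr 2
  exact LinearMap.ext (extX_ι s)

lemma extX_mem {p : ℕ} {z : ExteriorAlgebra ℚ (s → ℚ)} (hz : z ∈ ⋀[ℚ]^p (s → ℚ)) :
    extX s z ∈ AX (m + 1) ^ p := by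
  have h1 : extX s z ∈ (⋀[ℚ]^p (s → ℚ)).map (extX s).toLinearMap := ⟨z, hz, rfl⟩
  rw [map_extX] at h1
  have h2 : LinearMap.range (vecX s) ≤ AX (m + 1) := by
    rintro _ ⟨v, rfl⟩
    exact vecX_mem s v
  exact pow_le_pow_left' h2 p h1

/-- The nonzero points. -/
abbrev pts (m : ℕ) : Finset (Fin (m + 1)) := Finset.univ.erase 0

lemma range_vecX_pts : LinearMap.range (vecX (pts m)) = AX (m + 1) := by
  apply le_antisymm
  · rintro _ ⟨v, rfl⟩
    exact vecX_mem _ v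
  · have h (c : Fin (m + 1)) : ptX c ∈ LinearMap.range (vecX (pts m)) := by
      by_cases hc : c = 0
      · rw [hc, ptX_zero]
        exact zero_mem _
      · exact ⟨_, vecX_single (pts m) ⟨c, by simp [hc]⟩⟩
    rw [AX, Submodule.span_le]
    rintro _ ⟨e, rfl⟩
    rw [SetLike.mem_coe, X_eq_sub]
    exact sub_mem (h _) (h _)

lemma map_extX_pts (p : ℕ) : (⋀[ℚ]^p (pts m → ℚ)).map (extX (pts m)).toLinearMap
    = AX (m + 1) ^ p := by
  rw [map_extX, range_vecX_pts]

end Coordinates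

/-! ### Detecting homomorphisms -/

section Detection

variable {m : ℕ} {V : Type*} [AddCommGroup V] [Module ℚ V]

/-- The kernel of the defining matrix consists of the linear relations between the differences
`f j - f i`. -/
lemma sum_smul_sub_eq_zero {k : Edge (m + 1) → ℚ} (hk : IsRelation k) (f : Fin (m + 1) → V) :
    ∑ e, k e • (f e.1.2 - f e.1.1) = 0 := by
  have h1 : ∀ e : Edge (m + 1), f e.1.2 - f e.1.1
      = ∑ r : Fin (m + 1 - 1), (definingMatrix (m + 1) r e : ℚ) •
        (f (Fin.succ r) - f (Fin.castSucc r)) := by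
    intro e
    let g : ℕ → V := fun j => if h : j < m + 1 then f ⟨j, h⟩ else 0
    have hg (c : Fin (m + 1)) : f c = g c := by
      simp only [g]
      rw [dif_pos c.isLt]
    have hle : e.1.1.val ≤ e.1.2.val := (Fin.lt_def.1 e.2).le
    simp only [hg, definingMatrix, Fin.val_succ, Fin.val_castSucc]
    rw [Fin.sum_univ_eq_sum_range (fun r => (((if e.1.1.val ≤ r ∧ r < e.1.2.val then 1 else 0 : ℤ)
      : ℚ)) • (g (r + 1) - g r)) (m + 1 - 1), ← Finset.sum_Ico_sub g hle]
    simp only [Int.cast_ite, Int.cast_one, Int.cast_zero, ite_smul, one_smul, zero_smul]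
    rw [← Finset.sum_filter]
    refine Finset.sum_congr ?_ fun _ _ => rfl
    ext r
    have := e.1.2.isLt
    simp only [Finset.mem_Ico, Finset.mem_filter, Finset.mem_range]
    omega
  simp only [h1, Finset.smul_sum, smul_smul]
  rw [Finset.sum_comm]
  refine Finset.sum_eq_zero fun r _ => ?_
  rw [← Finset.sum_smul]
  have h2 := congrFun hk r
  simp only [Matrix.mulVec, dotProduct, Matrix.map_apply, Pi.zero_apply] at h2
  simp only [mul_comm (k _)]
  rw [h2, zero_smul]

/-- The vector part of a detecting homomorphism, on generators. -/
def detVec (b : Fin (m + 1) → V) : Gen (m + 1) → V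
  | Gen.x e => b e.1.2 - b e.1.1
  | Gen.y _ => 0
  | Gen.w _ => 0

/-- The scalar part of a detecting homomorphism, on generators. -/
def detScalar (α : Edge (m + 1) → ℚ) (δ : Fin (m + 1) → ℚ) : Gen (m + 1) → ℚ
  | Gen.x _ => 0
  | Gen.y e => δ e.1.2 - δ e.1.1
  | Gen.w e => α e

/-- The linear map with values `(v, c; 0, -v)`. The sign makes the square of such a matrix
vanish. -/
def detLin (b : Fin (m + 1) → V) (α : Edge (m + 1) → ℚ) (δ : Fin (m + 1) → ℚ) :
    (Gen (m + 1) →₀ ℚ) →ₗ[ℚ] Matrix (Fin 2) (Fin 2) (ExteriorAlgebra ℚ V) :=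
  Finsupp.linearCombination ℚ fun g =>
    !![ExteriorAlgebra.ι ℚ (detVec b g), algebraMap ℚ _ (detScalar α δ g);
      0, -ExteriorAlgebra.ι ℚ (detVec b g)]

variable {b : Fin (m + 1) → V} {α : Edge (m + 1) → ℚ} {δ : Fin (m + 1) → ℚ}

lemma exists_detLin (a : Gen (m + 1) →₀ ℚ) : ∃ (v : V) (c : ℚ), detLin b α δ a
    = !![ExteriorAlgebra.ι ℚ v, algebraMap ℚ _ c; 0, -ExteriorAlgebra.ι ℚ v] := by
  induction a using Finsupp.induction_linear with
  | zero => exact ⟨0, 0, by ext i j; fin_cases i <;> fin_cases j <;> simp⟩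
  | add a a' h h' =>
    obtain ⟨v, c, h⟩ := h
    obtain ⟨v', c', h'⟩ := h'
    refine ⟨v + v', c + c', ?_⟩
    rw [map_add, h, h']
    ext i j
    fin_cases i <;> fin_cases j <;> simp [add_comm]
  | single g r =>
    refine ⟨r • detVec b g, r • detScalar α δ g, ?_⟩
    rw [detLin, Finsupp.linearCombination_single]
    ext i j
    fin_cases i <;> fin_cases j <;> simp [Algebra.smul_def]

lemma detLin_sq (a : Gen (m + 1) →₀ ℚ) : detLin b α δ a * detLin b α δ a = 0 := by
  obtain ⟨v, c, h⟩ := exists_detLin (b := b) (α := α) (δ := δ) a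
  rw [h]
  ext i j
  fin_cases i <;> fin_cases j <;> simp [Matrix.mul_apply, Algebra.commutes]

/-- `detLin` as a homomorphism on the free graded commutative algebra. -/
def detFree (b : Fin (m + 1) → V) (α : Edge (m + 1) → ℚ) (δ : Fin (m + 1) → ℚ) :
    Free (m + 1) →ₐ[ℚ] Matrix (Fin 2) (Fin 2) (ExteriorAlgebra ℚ V) :=
  ExteriorAlgebra.lift ℚ ⟨detLin b α δ, detLin_sq⟩

lemma detFree_gen (g : Gen (m + 1)) : detFree b α δ (Free.gen g)
    = !![ExteriorAlgebra.ι ℚ (detVec b g), algebraMap ℚ _ (detScalar α δ g);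
      0, -ExteriorAlgebra.ι ℚ (detVec b g)] := by
  simp [detFree, Free.gen, detLin]

lemma detFree_rel (h : ∀ e, α e • (b e.1.2 - b e.1.1) = 0) ⦃a a' : Free (m + 1)⦄
    (hr : Rel (m + 1) a a') : detFree b α δ a = detFree b α δ a' := by
  induction hr with
  | x_mul_w e =>
    have h1 : ExteriorAlgebra.ι ℚ (b e.1.2 - b e.1.1) * algebraMap ℚ (ExteriorAlgebra ℚ V) (α e)
        = 0 := by
      rw [← Algebra.commutes, ← Algebra.smul_def, ← map_smul, h, map_zero]
    rw [map_mul, detFree_gen, detFree_gen, map_zero]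
    ext i j
    simp only [detVec, detScalar, map_zero, neg_zero]
    fin_cases i <;> fin_cases j <;> simp [Matrix.mul_apply, -map_sub, h1]
  | y_mul_w e =>
    rw [map_mul, detFree_gen, detFree_gen, map_zero]
    ext i j
    fin_cases i <;> fin_cases j <;> simp [Matrix.mul_apply, detVec]
  | arnold i j l hij hjl =>
    simp only [map_add, map_sub, map_mul, detFree_gen, map_zero]
    ext r s
    fin_cases r <;> fin_cases s <;> simp [detVec]
  | lin_x k hk =>
    have h1 : ∑ e, k e • ExteriorAlgebra.ι ℚ (b e.1.2 - b e.1.1) = 0 := by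
      simp only [← map_smul, ← map_sum]
      rw [sum_smul_sub_eq_zero hk, map_zero]
    simp only [map_sum, map_smul, detFree_gen, map_zero, detVec, detScalar]
    ext r s
    fin_cases r <;> fin_cases s <;> simp [Matrix.sum_apply, -map_sub, h1]
  | lin_y k hk =>
    have h1 : ∑ e, k e • algebraMap ℚ (ExteriorAlgebra ℚ V) (δ e.1.2 - δ e.1.1) = 0 := by
      simp only [← Algebra.linearMap_apply, ← map_smul, ← map_sum]
      rw [sum_smul_sub_eq_zero hk, map_zero]
    simp only [map_sum, map_smul, detFree_gen, map_zero, detVec, detScalar]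
    ext r s
    fin_cases r <;> fin_cases s <;> simp [Matrix.sum_apply, -map_sub, h1]

/-- The homomorphism `x i j ↦ (v, 0; 0, -v)` with `v = b j - b i`, `y i j ↦ (0, δ j - δ i; 0, 0)`
and `ω i j ↦ (0, α i j; 0, 0)`, where `α` is supported on the divisors with `b i = b j`. -/
def detect (b : Fin (m + 1) → V) (α : Edge (m + 1) → ℚ) (δ : Fin (m + 1) → ℚ)
    (h : ∀ e, α e • (b e.1.2 - b e.1.1) = 0) :
    E2Alg (m + 1) →ₐ[ℚ] Matrix (Fin 2) (Fin 2) (ExteriorAlgebra ℚ V) :=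
  RingQuot.liftAlgHom ℚ ⟨detFree b α δ, detFree_rel h⟩

variable (h : ∀ e, α e • (b e.1.2 - b e.1.1) = 0)

lemma detect_gen (g : Gen (m + 1)) : detect b α δ h (gen g)
    = !![ExteriorAlgebra.ι ℚ (detVec b g), algebraMap ℚ _ (detScalar α δ g);
      0, -ExteriorAlgebra.ι ℚ (detVec b g)] := by
  rw [detect, gen, RingQuot.liftAlgHom_mkAlgHom_apply, detFree_gen]

lemma detect_W (e : Edge (m + 1)) :
    detect b α δ h (W e) = !![0, algebraMap ℚ _ (α e); 0, 0] := by
  rw [W, detect_gen]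
  simp [detVec, detScalar]

lemma detect_ptX (hb : b 0 = 0) (c : Fin (m + 1)) : detect b α δ h (ptX c)
    = !![ExteriorAlgebra.ι ℚ (b c), 0; 0, -ExteriorAlgebra.ι ℚ (b c)] := by
  rw [ptX]
  split_ifs with hc
  · rw [X, detect_gen]
    simp [detVec, detScalar, edge, hb]
  · rw [Fin.le_zero_iff.1 (not_lt.1 hc), hb, map_zero]
    ext i j
    fin_cases i <;> fin_cases j <;> simp

lemma detect_ptY (hδ : δ 0 = 0) (c : Fin (m + 1)) : detect b α δ h (ptY c)
    = !![0, algebraMap ℚ _ (δ c); 0, 0] := by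
  rw [ptY]
  split_ifs with hc
  · rw [Y, detect_gen]
    simp [detVec, detScalar, edge, hδ]
  · rw [Fin.le_zero_iff.1 (not_lt.1 hc), hδ, map_zero]
    ext i j
    fin_cases i <;> fin_cases j <;> simp

lemma detect_extX {s : Finset (Fin (m + 1))} {b : Fin (m + 1) → (s → ℚ)}
    (h : ∀ e, α e • (b e.1.2 - b e.1.1) = 0) (hb : b 0 = 0)
    (hbs : ∀ c : s, b c = Pi.single c 1) (z : ExteriorAlgebra ℚ (s → ℚ)) :
    detect b α δ h (extX s z) 0 0 = z ∧ detect b α δ h (extX s z) 1 0 = 0 := by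
  induction z using ExteriorAlgebra.induction with
  | algebraMap r =>
    rw [AlgHom.commutes, AlgHom.commutes]
    simp [Matrix.algebraMap_matrix_apply]
  | ι v =>
    have h1 : detect b α δ h (vecX s v)
        = !![ExteriorAlgebra.ι ℚ v, 0; 0, -ExteriorAlgebra.ι ℚ v] := by
      have h2 : v = ∑ c, v c • Pi.single c (1 : ℚ) := by
        ext c
        simp [Finset.sum_apply, Pi.single_apply]
      rw [vecX, Fintype.linearCombination_apply, map_sum]
      conv_rhs => rw [h2]
      simp only [map_smul, detect_ptX h hb, hbs, map_sum]
      ext i j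
      fin_cases i <;> fin_cases j <;> simp [Matrix.sum_apply]
    rw [extX_ι, h1]
    simp
  | mul a c ha hc =>
    rw [map_mul, map_mul, Matrix.mul_apply, Matrix.mul_apply]
    simp [Fin.sum_univ_two, ha.1, ha.2, hc.1, hc.2]
  | add a c ha hc =>
    rw [map_add, map_add, Matrix.add_apply, Matrix.add_apply]
    simp [ha.1, ha.2, hc.1, hc.2]

/-- The points `c` of `s` as the standard basis vectors; the other points are sent to `0`. -/
def stdPt (s : Finset (Fin (m + 1))) (c : Fin (m + 1)) : s → ℚ :=
  if h : c ∈ s then Pi.single ⟨c, h⟩ 1 else 0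

lemma stdPt_coe {s : Finset (Fin (m + 1))} (c : s) : stdPt s c = Pi.single c 1 := by
  simp [stdPt]

lemma stdPt_of_notMem {s : Finset (Fin (m + 1))} {c : Fin (m + 1)} (hc : c ∉ s) :
    stdPt s c = 0 := dif_neg hc

end Detection

/-! ### The dimension of the space of highest weight vectors -/

section TopWeight

variable {m : ℕ}

/-- The nonzero points other than the second end point of `e`: the `x 0 c`, for `c` among them, are
a basis of the span of the classes `x` modulo `x e`. -/
abbrev edgePts (e : Edge (m + 1)) : Finset (Fin (m + 1)) := (pts m).erase e.1.2

/-- Coordinates on `TopW`: the `e`-component is multiplied by `ω e`. -/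
def topMap (m p : ℕ) :
    (∀ e : Edge (m + 1), ⋀[ℚ]^p (edgePts e → ℚ)) →ₗ[ℚ] E2Alg (m + 1) :=
  ∑ e, (LinearMap.mulRight ℚ (W e) ∘ₗ (extX (edgePts e)).toLinearMap
    ∘ₗ (⋀[ℚ]^p (edgePts e → ℚ)).subtype) ∘ₗ LinearMap.proj e

lemma topMap_apply (p : ℕ) (a : ∀ e : Edge (m + 1), ⋀[ℚ]^p (edgePts e → ℚ)) :
    topMap m p a = ∑ e, extX (edgePts e) (a e) * W e := by
  simp [topMap]

/-- The images of the points after identifying the end points of `e`. -/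
def edgePos (e : Edge (m + 1)) (c : Fin (m + 1)) : edgePts e → ℚ :=
  if c = e.1.2 then stdPt (edgePts e) e.1.1 else stdPt (edgePts e) c

lemma edgePos_zero (e : Edge (m + 1)) : edgePos e 0 = 0 := by
  have h : (0 : Fin (m + 1)) ≠ e.1.2 := ((Fin.zero_le _).trans_lt e.2).ne
  rw [edgePos, if_neg h, stdPt_of_notMem (by simp)]

lemma edgePos_coe (e : Edge (m + 1)) (c : edgePts e) : edgePos e c = Pi.single c 1 := by
  rw [edgePos, if_neg (Finset.ne_of_mem_erase c.2), stdPt_coe]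

lemma single_smul_edgePos (e f : Edge (m + 1)) :
    (Pi.single e 1 : Edge (m + 1) → ℚ) f • (edgePos e f.1.2 - edgePos e f.1.1) = 0 := by
  by_cases h : f = e
  · subst h
    rw [edgePos, edgePos, if_pos rfl, if_neg f.2.ne, sub_self, smul_zero]
  · rw [Pi.single_eq_of_ne h, zero_smul]

lemma topMap_injective (m p : ℕ) : Function.Injective (topMap m p) := by
  rw [injective_iff_map_eq_zero]
  intro a ha
  funext e
  have h1 := congrArg (fun b => detect (edgePos e) (Pi.single e 1) 0 (single_smul_edgePos e) b 0 1)
    ha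
  simp only [topMap_apply, map_sum, map_mul, detect_W, map_zero, Matrix.sum_apply] at h1
  rw [Finset.sum_eq_single e] at h1
  · rw [Matrix.mul_apply] at h1
    simp only [Fin.sum_univ_two, (detect_extX (single_smul_edgePos e) (edgePos_zero e)
      (edgePos_coe e) _).1] at h1
    exact Subtype.ext (by simpa using h1)
  · intro f _ hf
    rw [Pi.single_eq_of_ne hf, map_zero]
    simp [Matrix.mul_apply]
  · simp

/-- Multiplied by `ω e`, each class `x` agrees with a combination of the `x 0 c`, `c` in
`edgePts e`. -/
lemma AX_mul_span_W_le (e : Edge (m + 1)) :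
    AX (m + 1) * Submodule.span ℚ {W e}
      ≤ LinearMap.range (vecX (edgePts e)) * Submodule.span ℚ {W e} := by
  have hpt' (c : Fin (m + 1)) (hc : c ≠ e.1.2) :
      ptX c ∈ LinearMap.range (vecX (edgePts e)) := by
    by_cases h0 : c = 0
    · rw [h0, ptX_zero]
      exact zero_mem _
    · exact ⟨_, vecX_single (edgePts e) ⟨c, by simp [hc, h0]⟩⟩
  have hpt (c : Fin (m + 1)) : ∃ a ∈ LinearMap.range (vecX (edgePts e)),
      ptX c * W e = a * W e := by
    by_cases hc : c = e.1.2
    · refine ⟨_, hpt' e.1.1 e.2.ne, ?_⟩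
      have h := X_mul_W e
      rw [X_eq_sub, sub_mul, sub_eq_zero] at h
      rw [hc, h]
    · exact ⟨_, hpt' c hc, rfl⟩
  rw [AX, Submodule.span_mul_span, Submodule.span_le]
  rintro _ ⟨_, ⟨f, rfl⟩, _, rfl, rfl⟩
  obtain ⟨a, ha, h1⟩ := hpt f.1.1
  obtain ⟨a', ha', h2⟩ := hpt f.1.2
  simp only [SetLike.mem_coe]
  rw [X_eq_sub, sub_mul, h1, h2, ← sub_mul]
  exact Submodule.mul_mem_mul (sub_mem ha' ha) (Submodule.mem_span_singleton_self _)

lemma AX_pow_mul_span_W_le (e : Edge (m + 1)) (p : ℕ) :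
    AX (m + 1) ^ p * Submodule.span ℚ {W e}
      ≤ LinearMap.range (vecX (edgePts e)) ^ p * Submodule.span ℚ {W e} := by
  have hB : LinearMap.range (vecX (edgePts e)) ≤ V10 (m + 1) := by
    rintro _ ⟨v, rfl⟩
    exact AX_le_V10 (vecX_mem _ v)
  induction p with
  | zero => exact le_of_eq (by rw [pow_zero, pow_zero])
  | succ p ih =>
    set B := LinearMap.range (vecX (edgePts e))
    set L := Submodule.span ℚ {W e}
    calc AX (m + 1) ^ (p + 1) * L = AX (m + 1) * (AX (m + 1) ^ p * L) := by
          rw [pow_succ', mul_assoc]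
      _ ≤ AX (m + 1) * (B ^ p * L) := mul_le_mul_right ih _
      _ = B ^ p * (AX (m + 1) * L) := by
          rw [← mul_assoc, ((commute_of_le_V10 AX_le_V10 hB).pow_right p).eq, mul_assoc]
      _ ≤ B ^ p * (B * L) := mul_le_mul_right (AX_mul_span_W_le e) _
      _ = B ^ (p + 1) * L := by rw [← mul_assoc, ← pow_succ]

lemma range_topMap (m p : ℕ) : LinearMap.range (topMap m p) = TopW (m + 1) p := by
  apply le_antisymm
  · rintro _ ⟨a, rfl⟩
    rw [topMap_apply]
    exact Submodule.sum_mem _ fun e _ =>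
      Submodule.mul_mem_mul (extX_mem _ (a e).2) (W_mem_V01 e)
  · have hV : V01 (m + 1) = ⨆ e, Submodule.span ℚ {W e} := by
      rw [V01, ← Set.iUnion_singleton_eq_range, Submodule.span_iUnion]
    rw [TopW, hV, Submodule.mul_iSup]
    refine iSup_le fun e => (AX_pow_mul_span_W_le e p).trans ?_
    rw [← map_extX, Submodule.mul_le]
    rintro _ ⟨z, hz, rfl⟩ w hw
    obtain ⟨c, rfl⟩ := Submodule.mem_span_singleton.1 hw
    refine ⟨Pi.single e (c • ⟨z, hz⟩), ?_⟩
    rw [topMap_apply, Finset.sum_eq_single e]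
    · simp
    · intro f _ hf
      simp [Pi.single_eq_of_ne hf]
    · simp

lemma card_edge (n : ℕ) : Fintype.card (Edge n) = n.choose 2 := by
  rw [Fintype.card_subtype, Finset.card_filter, Fintype.sum_prod_type_right]
  simp only [← Finset.card_filter]
  have h (j : Fin n) : (Finset.univ.filter fun i => i < j).card = j.val := by
    rw [← Fin.card_Iio]
    congr 1
    ext i
    simp
  simp only [h]
  rw [Fin.sum_univ_eq_sum_range (fun i => i), Finset.sum_range_id, Nat.choose_two_right]

/-- For `m = 0` there are no divisors, and the truncation of `m - 1` does not matter. -/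
lemma finrank_TopW (m p : ℕ) :
    Module.finrank ℚ (TopW (m + 1) p) = (m + 1).choose 2 * (m - 1).choose p := by
  rw [← range_topMap, LinearMap.finrank_range_of_inj (topMap_injective m p),
    Module.finrank_pi_fintype]
  have h (e : Edge (m + 1)) :
      Module.finrank ℚ (⋀[ℚ]^p (edgePts e → ℚ)) = (m - 1).choose p := by
    have he : e.1.2 ∈ pts m :=
      Finset.mem_erase.2 ⟨((Fin.zero_le _).trans_lt e.2).ne', Finset.mem_univ _⟩
    rw [exteriorPower.finrank_eq, Module.finrank_fintype_fun_eq_card, Fintype.card_coe,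
      Finset.card_erase_of_mem he, Finset.card_erase_of_mem (Finset.mem_univ _), Finset.card_univ,
      Fintype.card_fin]
    rfl
  simp only [h, Finset.sum_const, Finset.card_univ, card_edge, smul_eq_mul]

end TopWeight

/-! ### The image of the highest weight vectors under the differential -/

section Image

variable {n m : ℕ}

lemma d_mul_of_mem_AX_pow {p : ℕ} {a : E2Alg n} (ha : a ∈ AX n ^ p) (w : E2Alg n) :
    d (a * w) = (-1 : ℚ) ^ p • (a * d w) := by
  induction p generalizing a with
  | zero =>
    rw [pow_zero, Submodule.mem_one] at ha
    obtain ⟨c, rfl⟩ := ha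
    simp [← Algebra.smul_def]
  | succ p ih =>
    rw [pow_succ'] at ha
    induction ha using Submodule.mul_induction_on' with
    | mem_mul_mem x hx b hb =>
      rw [mul_assoc, d_V10_mul (AX_le_V10 hx), ih hb, pow_succ']
      simp [mul_assoc]
    | add x _ y _ hx hy => rw [add_mul, map_add, hx, hy, add_mul, smul_add]

lemma map_d_TopW (n p : ℕ) : (TopW n p).map d = AX n ^ p * (V01 n).map d := by
  apply le_antisymm
  · rw [Submodule.map_le_iff_le_comap, TopW, Submodule.mul_le]
    intro a ha w hw
    rw [Submodule.mem_comap, d_mul_of_mem_AX_pow ha]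
    exact Submodule.smul_mem _ _ (Submodule.mul_mem_mul ha ⟨w, hw, rfl⟩)
  · rw [Submodule.mul_le]
    rintro a ha _ ⟨w, hw, rfl⟩
    refine ⟨(-1 : ℚ) ^ p • (a * w), Submodule.smul_mem _ _ (Submodule.mul_mem_mul ha hw), ?_⟩
    rw [map_smul, d_mul_of_mem_AX_pow ha, smul_smul, ← mul_pow]
    norm_num

lemma map_d_V01_le : (V01 n).map d ≤ AX n * AY n := by
  rw [V01, Submodule.map_span, Submodule.span_le]
  rintro _ ⟨_, ⟨e, rfl⟩, rfl⟩
  rw [d_W]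
  exact Submodule.mul_mem_mul (X_mem_AX e) (Y_mem_AY e)

lemma map_d_TopW_le (n p : ℕ) : (TopW n p).map d ≤ AX n ^ (p + 1) * AY n := by
  rw [map_d_TopW, pow_succ, mul_assoc]
  exact mul_le_mul_right map_d_V01_le _

lemma X_mul_Y_mem (e : Edge n) : X e * Y e ∈ (V01 n).map d := ⟨W e, W_mem_V01 e, d_W e⟩

lemma ptX_mul_ptY_mem (c : Fin (m + 1)) : ptX c * ptY c ∈ (V01 (m + 1)).map d := by
  by_cases h : 0 < c
  · rw [ptX, ptY, dif_pos h, dif_pos h]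
    exact X_mul_Y_mem _
  · rw [ptX, dif_neg h, zero_mul]
    exact zero_mem _

/-- The polarization of the quadratic map `x ↦ x y`. -/
lemma ptX_mul_ptY_add_mem (b c : Fin (m + 1)) :
    ptX b * ptY c + ptX c * ptY b ∈ (V01 (m + 1)).map d := by
  have key : ∀ b c : Fin (m + 1), b < c →
      ptX b * ptY c + ptX c * ptY b ∈ (V01 (m + 1)).map d := by
    intro b c h
    have h1 := X_mul_Y_mem (edge b c h)
    rw [X_eq_sub, Y_eq_sub] at h1
    have h2 := sub_mem (add_mem (ptX_mul_ptY_mem b) (ptX_mul_ptY_mem c)) h1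
    convert h2 using 1
    simp only [edge, sub_mul, mul_sub]
    abel
  rcases lt_trichotomy b c with h | h | h
  · exact key b c h
  · subst h
    exact add_mem (ptX_mul_ptY_mem b) (ptX_mul_ptY_mem b)
  · rw [add_comm (ptX b * ptY c)]
    exact key c b h

lemma vecX_mul_vecY_add_mem (s : Finset (Fin (m + 1))) (v w : s → ℚ) :
    vecX s v * vecY s w + vecX s w * vecY s v ∈ (V01 (m + 1)).map d := by
  have h : vecX s v * vecY s w + vecX s w * vecY s v
      = ∑ b, ∑ c, (v b * w c) • (ptX (b : Fin (m + 1)) * ptY (c : Fin (m + 1))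
        + ptX (c : Fin (m + 1)) * ptY (b : Fin (m + 1))) := by
    simp only [vecX, vecY, Fintype.linearCombination_apply, Finset.sum_mul_sum,
      smul_mul_smul_comm, smul_add, Finset.sum_add_distrib]
    congr 1
    rw [Finset.sum_comm]
    refine Finset.sum_congr rfl fun b _ => Finset.sum_congr rfl fun c _ => ?_
    rw [mul_comm]
  rw [h]
  exact Submodule.sum_mem _ fun b _ => Submodule.sum_mem _ fun c _ =>
    Submodule.smul_mem _ _ (ptX_mul_ptY_add_mem _ _)

lemma vecX_mul_vecY_add_eq_zero (s : Finset (Fin (m + 1))) (v : s → ℚ) :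
    vecX s v * vecY s v + vecY s v * vecX s v = 0 := by
  have hX := AX_le_V10 (vecX_mem s v)
  have hY := AY_le_V10 (vecY_mem s v)
  rw [mul_anticomm_of_mem_V10 hX hY, neg_add_cancel]

/-- The linear map with values `(x, y; 0, x)`. -/
def lowerLin (s : Finset (Fin (m + 1))) :
    (s → ℚ) →ₗ[ℚ] Matrix (Fin 2) (Fin 2) (E2Alg (m + 1)) where
  toFun v := !![vecX s v, vecY s v; 0, vecX s v]
  map_add' a b := by
    ext i j; fin_cases i <;> fin_cases j <;> simp
  map_smul' c a := by
    ext i j; fin_cases i <;> fin_cases j <;> simp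

/-- The homomorphism `z ↦ (z, z'; 0, z)`, where `z ↦ z'` is the lowering operator, the derivation
with `x ↦ y`. -/
def lowerHom (s : Finset (Fin (m + 1))) :
    ExteriorAlgebra ℚ (s → ℚ) →ₐ[ℚ] Matrix (Fin 2) (Fin 2) (E2Alg (m + 1)) :=
  ExteriorAlgebra.lift ℚ ⟨lowerLin s, fun v => by
    have h1 := mul_self_of_mem_AX (vecX_mem s v)
    have h2 := vecX_mul_vecY_add_eq_zero s v
    ext i j
    fin_cases i <;> fin_cases j <;> simp [lowerLin, Matrix.mul_apply, h1, h2]⟩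

lemma lowerHom_ι (s : Finset (Fin (m + 1))) (v : s → ℚ) :
    lowerHom s (ExteriorAlgebra.ι ℚ v) = !![vecX s v, vecY s v; 0, vecX s v] := by
  rw [lowerHom, ExteriorAlgebra.lift_ι_apply]
  rfl

lemma lowerHom_diag (s : Finset (Fin (m + 1))) (z : ExteriorAlgebra ℚ (s → ℚ)) :
    lowerHom s z 0 0 = extX s z ∧ lowerHom s z 1 1 = extX s z ∧ lowerHom s z 1 0 = 0 := by
  induction z using ExteriorAlgebra.induction with
  | algebraMap r =>
    rw [AlgHom.commutes, AlgHom.commutes]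
    simp [Matrix.algebraMap_matrix_apply]
  | ι v => simp [lowerHom_ι, extX_ι]
  | mul a c ha hc =>
    rw [map_mul, map_mul, Matrix.mul_apply, Matrix.mul_apply, Matrix.mul_apply]
    simp [Fin.sum_univ_two, ha.1, ha.2, hc.1, hc.2]
  | add a c ha hc =>
    rw [map_add, map_add, Matrix.add_apply, Matrix.add_apply, Matrix.add_apply]
    simp [ha.1, ha.2, hc.1, hc.2]

/-- The lowering operator: the upper right entry of `lowerHom`. -/
def lower (s : Finset (Fin (m + 1))) : ExteriorAlgebra ℚ (s → ℚ) →ₗ[ℚ] E2Alg (m + 1) where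
  toFun z := lowerHom s z 0 1
  map_add' a b := by simp
  map_smul' c a := by simp

lemma lower_ι (s : Finset (Fin (m + 1))) (v : s → ℚ) :
    lower s (ExteriorAlgebra.ι ℚ v) = vecY s v := by
  simp [lower, lowerHom_ι]

lemma lower_mul (s : Finset (Fin (m + 1))) (z z' : ExteriorAlgebra ℚ (s → ℚ)) :
    lower s (z * z') = extX s z * lower s z' + lower s z * extX s z' := by
  simp [lower, Matrix.mul_apply, (lowerHom_diag s z).1, (lowerHom_diag s z').2.1]

lemma mul_anticomm_of_mem_AX_pow {r : ℕ} {a b : E2Alg n} (ha : a ∈ V10 n) (hb : b ∈ AX n ^ r) :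
    a * b = (-1 : ℚ) ^ r • (b * a) := by
  induction r generalizing b with
  | zero =>
    rw [pow_zero, Submodule.mem_one] at hb
    obtain ⟨c, rfl⟩ := hb
    rw [pow_zero, one_smul, Algebra.commutes]
  | succ r ih =>
    rw [pow_succ'] at hb
    induction hb using Submodule.mul_induction_on' with
    | mem_mul_mem x hx b hb =>
      rw [← mul_assoc, mul_anticomm_of_mem_V10 ha (AX_le_V10 hx), neg_mul, mul_assoc, ih hb,
        pow_succ']
      simp [mul_assoc]
    | add x _ y _ hx hy => rw [mul_add, hx, hy, add_mul, smul_add]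

/-- Modulo boundaries, `x` and `y` factors may be exchanged. -/
lemma exchange_mem (s : Finset (Fin (m + 1))) (v w : s → ℚ) {r : ℕ} {b : E2Alg (m + 1)}
    (hb : b ∈ AX (m + 1) ^ r) : vecY s v * b * vecX s w - vecX s v * b * vecY s w
      ∈ AX (m + 1) ^ r * (V01 (m + 1)).map d := by
  have hX (u) := AX_le_V10 (vecX_mem s u)
  have hY (u) := AY_le_V10 (vecY_mem s u)
  have h := vecX_mul_vecY_add_mem s v w
  rw [mul_anticomm_of_mem_AX_pow (hY v) hb, mul_anticomm_of_mem_AX_pow (hX v) hb,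
    smul_mul_assoc, smul_mul_assoc, ← smul_sub, mul_assoc, mul_assoc,
    mul_anticomm_of_mem_V10 (hY v) (hX w), ← mul_sub]
  refine Submodule.smul_mem _ _ (Submodule.mul_mem_mul hb ?_)
  rw [← neg_mem_iff]
  convert h using 1
  abel

lemma lower_mul_sub_mem (s : Finset (Fin (m + 1))) (w : s → ℚ) {r : ℕ}
    {z : ExteriorAlgebra ℚ (s → ℚ)} (hz : z ∈ ⋀[ℚ]^(r + 1) (s → ℚ)) :
    lower s z * vecX s w - (r + 1 : ℚ) • (extX s z * vecY s w)
      ∈ AX (m + 1) ^ r * (V01 (m + 1)).map d := by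
  induction r generalizing z with
  | zero =>
    rw [zero_add, ExteriorAlgebra.exteriorPower, pow_one] at hz
    obtain ⟨v, rfl⟩ := hz
    have h := exchange_mem s v w (r := 0) (b := 1)
      (by rw [pow_zero]; exact Submodule.one_le.1 le_rfl)
    simpa [lower_ι, extX_ι] using h
  | succ r ih =>
    rw [ExteriorAlgebra.exteriorPower, pow_succ'] at hz
    induction hz using Submodule.mul_induction_on' with
    | mem_mul_mem x hx z hz =>
      obtain ⟨v, rfl⟩ := hx
      have h1 := exchange_mem s v w (extX_mem s hz)
      have h2 := Submodule.mul_mem_mul (vecX_mem s v) (ih hz)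
      rw [← mul_assoc, ← pow_succ'] at h2
      convert add_mem h1 h2 using 1
      rw [lower_mul, lower_ι, map_mul, extX_ι, Nat.cast_succ]
      simp only [mul_sub, add_mul, mul_smul_comm, mul_assoc]
      module
    | add x _ y _ hx hy =>
      convert add_mem hx hy using 1
      rw [map_add, map_add, add_mul, add_mul, smul_add]
      abel

/-- Coordinates on `AX ^ p * AY`: the `c`-component is multiplied by `y 0 c`. -/
def mixedMap (m p : ℕ) :
    (pts m → ⋀[ℚ]^p (pts m → ℚ)) →ₗ[ℚ] E2Alg (m + 1) :=
  ∑ c, (LinearMap.mulRight ℚ (vecY (pts m) (Pi.single c 1)) ∘ₗ (extX (pts m)).toLinearMap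
    ∘ₗ (⋀[ℚ]^p (pts m → ℚ)).subtype) ∘ₗ LinearMap.proj c

/-- The raising operator `y ↦ x` in these coordinates. -/
def raise (m p : ℕ) :
    (pts m → ⋀[ℚ]^p (pts m → ℚ)) →ₗ[ℚ] ExteriorAlgebra ℚ (pts m → ℚ) :=
  ∑ c, (LinearMap.mulRight ℚ (ExteriorAlgebra.ι ℚ (Pi.single c 1))
    ∘ₗ (⋀[ℚ]^p (pts m → ℚ)).subtype) ∘ₗ LinearMap.proj c

lemma mixedMap_apply (p : ℕ) (a : pts m → ⋀[ℚ]^p (pts m → ℚ)) :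
    mixedMap m p a = ∑ c, extX (pts m) (a c) * vecY (pts m) (Pi.single c 1) := by
  simp [mixedMap]

lemma raise_apply (p : ℕ) (a : pts m → ⋀[ℚ]^p (pts m → ℚ)) :
    raise m p a = ∑ c, (a c : ExteriorAlgebra ℚ (pts m → ℚ))
      * ExteriorAlgebra.ι ℚ (Pi.single c 1) := by
  simp [raise]

lemma zero_smul_stdPt (e : Edge (m + 1)) :
    (0 : Edge (m + 1) → ℚ) e • (stdPt (pts m) e.1.2 - stdPt (pts m) e.1.1) = 0 := by
  rw [Pi.zero_apply, zero_smul]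

lemma extX_pts_injective (m : ℕ) : Function.Injective (extX (pts m)) := by
  rw [injective_iff_map_eq_zero]
  intro z hz
  rw [← (detect_extX (δ := 0) zero_smul_stdPt (stdPt_of_notMem (by simp)) stdPt_coe z).1, hz,
    map_zero]
  rfl

lemma mixedMap_injective (m p : ℕ) : Function.Injective (mixedMap m p) := by
  rw [injective_iff_map_eq_zero]
  intro a ha
  funext c
  have hc : (c : Fin (m + 1)) ≠ 0 := Finset.ne_of_mem_erase c.2
  have hδ : (Pi.single (c : Fin (m + 1)) 1 : Fin (m + 1) → ℚ) 0 = 0 := Pi.single_eq_of_ne' hc 1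
  have h1 := congrArg (fun b => detect (stdPt (pts m)) 0 (Pi.single (c : Fin (m + 1)) 1)
    zero_smul_stdPt b 0 1) ha
  simp only [mixedMap_apply, map_sum, map_mul, vecY_single, detect_ptY zero_smul_stdPt hδ,
    map_zero, Matrix.sum_apply] at h1
  rw [Finset.sum_eq_single c] at h1
  · rw [Matrix.mul_apply] at h1
    simp only [Fin.sum_univ_two, (detect_extX zero_smul_stdPt (stdPt_of_notMem (by simp))
      stdPt_coe _).1] at h1
    exact Subtype.ext (by simpa using h1)
  · intro f _ hf
    rw [Pi.single_eq_of_ne (Subtype.coe_injective.ne hf), map_zero]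
    simp [Matrix.mul_apply]
  · simp

lemma range_mixedMap (m p : ℕ) :
    LinearMap.range (mixedMap m p) = AX (m + 1) ^ p * AY (m + 1) := by
  apply le_antisymm
  · rintro _ ⟨a, rfl⟩
    rw [mixedMap_apply]
    exact Submodule.sum_mem _ fun c _ =>
      Submodule.mul_mem_mul (extX_mem _ (a c).2) (vecY_mem _ _)
  · have hmem : ∀ b ∈ AX (m + 1) ^ p, ∀ c : Fin (m + 1),
        b * ptY c ∈ LinearMap.range (mixedMap m p) := by
      intro b hb c
      by_cases hc : c = 0
      · rw [hc, ptY_zero, mul_zero]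
        exact zero_mem _
      · rw [← map_extX_pts] at hb
        obtain ⟨z, hz, rfl⟩ := hb
        let c' : pts m := ⟨c, by simp [hc]⟩
        refine ⟨Pi.single c' ⟨z, hz⟩, ?_⟩
        rw [mixedMap_apply, Finset.sum_eq_single c']
        · rw [vecY_single]
          simp [c']
        · intro f _ hf
          simp [Pi.single_eq_of_ne hf]
        · simp
    rw [Submodule.mul_le]
    intro b hb y hy
    induction hy using Submodule.span_induction with
    | mem y hy =>
      obtain ⟨e, rfl⟩ := hy
      rw [Y_eq_sub, mul_sub]
      exact sub_mem (hmem b hb _) (hmem b hb _)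
    | zero => simp
    | add v w _ _ hv hw => rw [mul_add]; exact add_mem hv hw
    | smul c v _ hv => rw [mul_smul_comm]; exact Submodule.smul_mem _ c hv

lemma range_raise (m p : ℕ) : LinearMap.range (raise m p) = ⋀[ℚ]^(p + 1) (pts m → ℚ) := by
  have hpow : ⋀[ℚ]^(p + 1) (pts m → ℚ)
      = ⋀[ℚ]^p (pts m → ℚ) * LinearMap.range (ExteriorAlgebra.ι ℚ) := pow_succ _ _
  rw [hpow]
  apply le_antisymm
  · rintro _ ⟨a, rfl⟩
    rw [raise_apply]
    exact Submodule.sum_mem _ fun c _ => Submodule.mul_mem_mul (a c).2 ⟨_, rfl⟩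
  · rw [Submodule.mul_le]
    rintro z hz _ ⟨v, rfl⟩
    refine ⟨fun c => v c • ⟨z, hz⟩, ?_⟩
    have h2 : v = ∑ c, v c • Pi.single c (1 : ℚ) := by
      ext c
      simp [Finset.sum_apply, Pi.single_apply]
    rw [raise_apply]
    conv_rhs => rw [h2]
    simp [Finset.mul_sum]

lemma act_upperUnip_extX (s : Finset (Fin (m + 1))) (z : ExteriorAlgebra ℚ (s → ℚ)) :
    act upperUnip (extX s z) = extX s z := by
  have hX (c : Fin (m + 1)) : act upperUnip (ptX c) = ptX c := by
    rw [ptX]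
    split_ifs
    · rw [act_X]
      simp [upperUnip]
    · simp
  have : (act upperUnip).comp (extX s) = extX s := by
    refine ExteriorAlgebra.hom_ext (LinearMap.ext fun v => ?_)
    simp only [LinearMap.comp_apply, AlgHom.toLinearMap_apply, AlgHom.comp_apply, extX_ι, vecX,
      Fintype.linearCombination_apply, map_sum, map_smul, hX]
  exact DFunLike.congr_fun this z

/-- The action of the unipotent element on `AX ^ p * AY` is given by the raising operator. -/
lemma act_upperUnip_mixedMap (p : ℕ) (a : pts m → ⋀[ℚ]^p (pts m → ℚ)) :
    act upperUnip (mixedMap m p a) = mixedMap m p a + extX (pts m) (raise m p a) := by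
  have hY (c : Fin (m + 1)) : act upperUnip (ptY c) = ptY c + ptX c := by
    rw [ptY, ptX]
    split_ifs
    · rw [act_Y]
      simp [upperUnip, add_comm]
    · simp
  simp only [mixedMap_apply, raise_apply, map_sum, map_mul, act_upperUnip_extX, vecY_single, hY,
    mul_add, Finset.sum_add_distrib, extX_ι, vecX_single]

lemma act_upperUnip_eq_self_iff (p : ℕ) (a : pts m → ⋀[ℚ]^p (pts m → ℚ)) :
    act upperUnip (mixedMap m p a) = mixedMap m p a ↔ raise m p a = 0 := by
  rw [act_upperUnip_mixedMap, add_eq_left, map_eq_zero_iff _ (extX_pts_injective m)]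

/-- Lowering after raising is multiplication by `p + 2`, modulo boundaries of highest weight
vectors; hence the highest weight vectors of `AX ^ (p + 1) * AY` are such boundaries. -/
lemma mixedMap_mem_of_raise_eq_zero {p : ℕ} {a : pts m → ⋀[ℚ]^(p + 1) (pts m → ℚ)}
    (ha : raise m (p + 1) a = 0) : mixedMap m (p + 1) a ∈ (TopW (m + 1) p).map d := by
  have h1 : ∑ c, (lower (pts m) (a c) * vecX (pts m) (Pi.single c 1)
      - (p + 1 : ℚ) • (extX (pts m) (a c) * vecY (pts m) (Pi.single c 1)))
      ∈ AX (m + 1) ^ p * (V01 (m + 1)).map d :=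
    Submodule.sum_mem _ fun c _ => lower_mul_sub_mem (pts m) _ (a c).2
  have h2 := congrArg (lower (pts m)) ha
  simp only [raise_apply, map_sum, lower_mul, lower_ι, extX_ι, map_zero,
    Finset.sum_add_distrib, ← mixedMap_apply] at h2
  rw [Finset.sum_sub_distrib, ← Finset.smul_sum, ← mixedMap_apply, eq_neg_of_add_eq_zero_right h2,
    ← map_d_TopW] at h1
  have h3 : -mixedMap m (p + 1) a - (p + 1 : ℚ) • mixedMap m (p + 1) a
      = (-(p + 2) : ℚ) • mixedMap m (p + 1) a := by module
  rw [h3] at h1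
  exact (Submodule.smul_mem_iff _ (neg_ne_zero.2 (by positivity))).1 h1

lemma mem_map_d_TopW {p : ℕ} {a : E2Alg (m + 1)} (ha : a ∈ AX (m + 1) ^ (p + 1) * AY (m + 1))
    (h : act upperUnip a = a) : a ∈ (TopW (m + 1) p).map d := by
  rw [← range_mixedMap] at ha
  obtain ⟨b, rfl⟩ := ha
  exact mixedMap_mem_of_raise_eq_zero ((act_upperUnip_eq_self_iff (p + 1) b).1 h)

lemma act_upperUnip_TopW {p : ℕ} {a : E2Alg (m + 1)} (ha : a ∈ TopW (m + 1) p) :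
    act upperUnip a = a := by
  obtain ⟨φ, rfl⟩ := exists_intertwiningMap ha
  exact congrArg Subtype.val (upperUnip_topVec φ)

lemma map_d_TopW_eq (m p : ℕ) : (TopW (m + 1) p).map d
    = (LinearMap.ker (raise m (p + 1))).map (mixedMap m (p + 1)) := by
  apply le_antisymm
  · intro b hb
    have h1 := map_d_TopW_le _ _ hb
    rw [← range_mixedMap] at h1
    obtain ⟨a, rfl⟩ := h1
    refine ⟨a, (act_upperUnip_eq_self_iff (p + 1) a).1 ?_, rfl⟩
    obtain ⟨t, ht, h2⟩ := hb
    rw [← h2, ← d_act, act_upperUnip_TopW ht]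
  · rintro _ ⟨a, ha, rfl⟩
    exact mixedMap_mem_of_raise_eq_zero ha

lemma finrank_map_d_TopW (m p : ℕ) :
    m.choose (p + 2) + Module.finrank ℚ ((TopW (m + 1) p).map d) = m * m.choose (p + 1) := by
  have h1 := (raise m (p + 1)).finrank_range_add_finrank_ker
  have h2 : Module.finrank ℚ (pts m → ℚ) = m := by
    rw [Module.finrank_fintype_fun_eq_card, Fintype.card_coe,
      Finset.card_erase_of_mem (Finset.mem_univ _), Finset.card_univ, Fintype.card_fin]
    rfl
  rw [range_raise, exteriorPower.finrank_eq, h2, Module.finrank_pi_fintype] at h1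
  simp only [exteriorPower.finrank_eq, h2, Finset.sum_const, Finset.card_univ, smul_eq_mul] at h1
  rw [← Module.finrank_fintype_fun_eq_card ℚ] at h1
  rw [h2] at h1
  rw [map_d_TopW_eq, ← h1,
    (Submodule.equivMapOfInjective _ (mixedMap_injective m (p + 1)) _).finrank_eq]

end Image

/-! ### Binomial coefficients -/

section Binomials

lemma choose_two_mul_choose (m p : ℕ) :
    (m + 1).choose 2 * (m - 1).choose p
      = (m + 1).choose (p + 2) * ((p + 1).choose 2 + (p + 1)) := by
  have h : (p + 1).choose 2 + (p + 1) = (p + 2).choose 2 := by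
    rw [Nat.choose_succ_succ' (p + 1) 1, Nat.choose_one_right, add_comm]
  rw [h]
  rcases lt_or_ge m (p + 1) with hm | hm
  · rw [Nat.choose_eq_zero_of_lt (show m + 1 < p + 2 by omega), zero_mul]
    rcases Nat.eq_zero_or_pos m with rfl | h0
    · simp
    · rw [Nat.choose_eq_zero_of_lt (show m - 1 < p by omega), mul_zero]
  · rw [Nat.choose_mul (show 2 ≤ p + 2 by omega)]
    rfl

lemma mul_choose_succ (m p : ℕ) :
    m * m.choose (p + 1) = m.choose (p + 2) + (p + 1) * (m + 1).choose (p + 2) := by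
  have h1 := Nat.choose_succ_right_eq m (p + 1)
  rw [Nat.choose_succ_succ' m (p + 1)]
  rcases le_or_gt (p + 1) m with h | h
  · obtain ⟨r, rfl⟩ := Nat.exists_eq_add_of_le h
    rw [Nat.add_sub_cancel_left] at h1
    linarith
  · rw [Nat.choose_eq_zero_of_lt h, Nat.choose_eq_zero_of_lt (h.trans (Nat.lt_succ_self _))]
    simp

end Binomials

/-! ### The multiplicities -/

section Final

/-- Rank-nullity for the differential on the highest weight vectors. -/
lemma finrank_map_d_add_finrank_inf_ker (m p : ℕ) :
    Module.finrank ℚ ((TopW (m + 1) p).map d)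
      + Module.finrank ℚ (TopW (m + 1) p ⊓ LinearMap.ker d : Submodule ℚ (E2Alg (m + 1)))
      = Module.finrank ℚ (TopW (m + 1) p) := by
  have : Module.Finite ℚ (TopW (m + 1) p) := by
    rw [← range_topMap]
    infer_instance
  rw [← (d.domRestrict (TopW (m + 1) p)).finrank_range_add_finrank_ker,
    LinearMap.range_domRestrict, LinearMap.ker_domRestrict, ← Submodule.map_comap_subtype,
    (Submodule.equivMapOfInjective _ (Submodule.subtype_injective _) _).finrank_eq]

/-- The formulas for a positive number `m + 1` of points, without subtraction. -/
lemma e3_formula (m p : ℕ) :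
    e3 (m + 1) p 1 p = (m + 1).choose (p + 2) * (p + 1).choose 2 ∧
      e3 (m + 1) p 1 p + e2 (m + 1) (p + 2) 0 p = e2 (m + 1) p 1 p := by
  have h1 := finrank_TopW m p
  have h2 := finrank_map_d_TopW m p
  have h3 := finrank_map_d_add_finrank_inf_ker m p
  rw [e3_one_eq_finrank, e2_one_eq_finrank,
    e2_zero_eq_finrank _ _ fun a ha h => mem_map_d_TopW ha h]
  have h4 := choose_two_mul_choose m p
  have h5 := mul_choose_succ m p
  rw [mul_add, mul_comm _ (p + 1)] at h4
  constructor <;> omega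

end Final

end BraidElliptic

end

theorem mainTheorem10 (n p : ℕ) (hn : 1 ≤ n) :
    BraidElliptic.e3 n p 1 p = n.choose (p + 2) * (p + 1).choose 2 ∧
      (BraidElliptic.e3 n p 1 p : ℤ) =
        (BraidElliptic.e2 n p 1 p : ℤ) - (BraidElliptic.e2 n (p + 2) 0 p : ℤ) := by
  obtain ⟨m, rfl⟩ := Nat.exists_eq_add_of_le' hn
  obtain ⟨h1, h2⟩ := BraidElliptic.e3_formula m p
  exact ⟨h1, by omega⟩
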